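/- Let $d\ge 1$ and let $\tau_1,\dots,\tau_{N_g}\in\mathbb R^d$ be distinct grid points with convex hull $\mathrm{Hull}$. Let $\mathcal T=\{T_n\}_{n=1}^{N_s}$ be a triangulation of them (for instance a Delaunay triangulation): each $T_n$ is a $d$-simplex whose vertices are grid points with index set $\mathcal V_n$, $|\mathcal V_n|=d+1$; the $T_n$ are distinct and cover $\mathrm{Hull}$; every grid point is a vertex of some simplex; any two simplices meet exactly in the (possibly empty) face spanned by their common vertices. For $c\in\mathbb R^{N_g}$ let $f_c=\sum_k c_k s_k$, where the hat function $s_k(x)$ is the barycentric coordinate of $x$ with respect to $\tau_k$ in any simplex that contains $x$ and has $\tau_k$ as a vertex, and $s_k(x)=0$ if there is none. Thus $f_c$ is the continuous piecewise-linear function on $\mathrm{Hull}$ with $f_c(\tau_k)=c_k$. For an open set $\Omega\subset\mathbb R^d$ let $$\mathrm{HTV}_\Omega(f)=\sup\Big\{\sum_{p,q=1}^d\int_\Omega f\,\partial_p\partial_q F_{p,q}\,dx\ :\ F\in\mathcal S(\mathbb R^d;\mathbb R^{d\times d}),\ \mathrm{supp}\,F\subset\Omega,\ \sup_x\sigma_{\max}(F(x))\le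 1\Big\},$$ the total variation on $\Omega$ of the distributional Hessian of $f$ with respect to the Schatten-1 norm; write $\mathrm{HTV}(f_c)$ for $\mathrm{HTV}_{\mathrm{int}\,\mathrm{Hull}}(f_c)$. Let $\mathcal N$ be the set of unordered pairs of neighboring simplices ($|\mathcal V_A\cap\mathcal V_B|=d$), each listed once as $(A,B)$ with $A<B$. For $(A,B)\in\mathcal N$ let $\tilde\tau_0$ be the vertex of $T_A$ not in $T_B$, $\tilde\tau_1,\dots,\tilde\tau_d$ the common vertices in increasing order of index, and $\tilde\tau_{d+1}$ the vertex of $T_B$ not in $T_A$. Put $$G_{A,B}=\begin{bmatrix}G_A\mathbf 1 & G_B-G_A & -G_B\mathbf 1\end{bmatrix}W_{A,B},$$ where $G_A$ (resp. $G_B$) is the inverse of the matrix with rows $(\tilde\tau_0-\tilde\tau_l)^T$ (resp. $(\tilde\tau_{d+1}-\tilde\tau_l)^T$), $l=1,\dots,d$, and $W_{A,B}\in\{0,1\}^{(d+2)\times N_g}$ has $(p,k)$ entry $1$ iff $\tilde\tau_p=\tau_k$. Let $u_{A,B}$ be the unit normal of the common facet obtained by normalizing the first $d$ entries of the first column of the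 inverse of the matrix with rows $(\tilde\tau_p^T,1)$, $p=0,\dots,d$. Let $\mathrm{Vol}_{A,B}$ be the $(d-1)$-dimensional volume of $T_A\cap T_B$, let $R_{A,B}=\mathrm{Vol}_{A,B}\,u_{A,B}^TG_{A,B}$, and let $L\in\mathbb R^{|\mathcal N|\times N_g}$ be the matrix with rows $R_{A,B}$. Then: 1. For every $c\in\mathbb R^{N_g}$, $\ \mathrm{HTV}(f_c)=\sum_{(A,B)\in\mathcal N}|R_{A,B}\,c|=\|Lc\|_1$. 2. Each row of $L$ has at most $d+2$ nonzero entries. 3. For all data $x_1,\dots,x_M\in\mathrm{Hull}$, $y\in\mathbb R^M$ and $\lambda\ge 0$, with $H=(s_k(x_m))_{m,k}\in\mathbb R^{M\times N_g}$, we have for every $c$ $$\sum_{m=1}^M\tfrac12\,(y_m-f_c(x_m))^2+\lambda\,\mathrm{HTV}(f_c)=\tfrac12\|y-Hc\|_2^2+\lambda\|Lc\|_1.$$ In particular, $f_c$ minimizes $f\mapsto\sum_m\frac12(y_m-f(x_m))^2+\lambda\,\mathrm{HTV}(f)$ over $\{f_{c'}:c'\in\mathbb R^{N_g}\}$ if and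 only if $c$ minimizes the generalized LASSO objective $c'\mapsto\frac12\|y-Hc'\|_2^2+\lambda\|Lc'\|_1$ over $\mathbb R^{N_g}$. -/

import Mathlib

open MeasureTheory
open scoped Matrix SchwartzMap LineDeriv

/-- The Euclidean space `ℝ^d`. -/
abbrev RSpace (d : ℕ) : Type := EuclideanSpace ℝ (Fin d)

/-- The `p`-th vector of the canonical basis of `ℝ^d`. -/
noncomputable def canonicalVec {d : ℕ} (p : Fin d) : RSpace d := EuclideanSpace.single p 1

/-- Matrix-valued Schwartz functions `𝓢(ℝ^d; ℝ^{d×d})`, given by their entries. -/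
abbrev MatrixSchwartz (d : ℕ) : Type := Fin d → Fin d → 𝓢(RSpace d, ℝ)

/-- Admissible test functions on the open set `Ω`: matrix-valued Schwartz functions whose entries
are supported in `Ω` and with `‖F‖_{𝓢_∞} ≤ 1`, that is, with the largest singular value (the
Euclidean operator norm) of `F x` at most `1` at every point `x`. For `Ω = ℝ^d` the support
condition is void. -/
def IsAdmissibleTest {d : ℕ} (Ω : Set (RSpace d)) (F : MatrixSchwartz d) : Prop :=
  (∀ p q, tsupport (F p q : RSpace d → ℝ) ⊆ Ω) ∧
    ∀ x, ‖Matrix.toEuclideanCLM (𝕜 := ℝ) (n := Fin d) (Matrix.of fun p q => F p q x)‖ ≤ 1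

/-- The duality product `⟨H{f}, F⟩ = ∑_{p,q} ⟨∂_p ∂_q f, F_{p,q}⟩` of the distributional Hessian of
`f` on `Ω` with a test function: `⟨∂_p ∂_q f, φ⟩ = ∫_Ω f ∂_p ∂_q φ`. -/
noncomputable def hessianPairing {d : ℕ} (Ω : Set (RSpace d)) (f : RSpace d → ℝ)
    (F : MatrixSchwartz d) : ℝ :=
  ∑ p : Fin d, ∑ q : Fin d,
    ∫ x in Ω, f x * (∂_{canonicalVec p} (∂_{canonicalVec q} (F p q)) : 𝓢(RSpace d, ℝ)) x

/-- The Hessian total variation of `f` on the open set `Ω`: the mixed norm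
`‖H{f}‖_{𝓢_1, 𝓜}` of the distributional Hessian, defined by duality. -/
noncomputable def HTV {d : ℕ} (Ω : Set (RSpace d)) (f : RSpace d → ℝ) : EReal :=
  ⨆ F : {F : MatrixSchwartz d // IsAdmissibleTest Ω F}, ((hessianPairing Ω f F.1 : ℝ) : EReal)

/-- A triangulation of the set of grid points `τ_0, …, τ_{Ng-1}` of `ℝ^d` into `Ns` simplices; the
`n`-th simplex is the convex hull of the grid points with index in `V n`. -/
structure GridTriangulation (d Ng Ns : ℕ) where
  /-- the grid points -/
  τ : Fin Ng → RSpace d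
  /-- the vertex indices of each simplex -/
  V : Fin Ns → Finset (Fin Ng)
  τ_injective : Function.Injective τ
  V_injective : Function.Injective V
  card_V : ∀ n, (V n).card = d + 1
  affineIndependent : ∀ n, AffineIndependent ℝ (fun i : V n => τ i)
  /-- every grid point is a vertex of the triangulation -/
  exists_mem_V : ∀ k, ∃ n, k ∈ V n
  /-- the simplices cover the convex hull of the grid points -/
  iUnion_simplex : (⋃ n, convexHull ℝ (τ '' (V n : Set (Fin Ng)))) = convexHull ℝ (Set.range τ)
  /-- two simplices meet in the (possibly empty) face spanned by their common vertices -/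
  inter_simplex : ∀ m n,
    convexHull ℝ (τ '' (V m : Set (Fin Ng))) ∩ convexHull ℝ (τ '' (V n : Set (Fin Ng))) =
      convexHull ℝ (τ '' ((V m ∩ V n : Finset (Fin Ng)) : Set (Fin Ng)))

namespace GridTriangulation

variable {d Ng Ns : ℕ} (T : GridTriangulation d Ng Ns)

/-- The `n`-th simplex of the triangulation. -/
def simplex (n : Fin Ns) : Set (RSpace d) := convexHull ℝ (T.τ '' (T.V n : Set (Fin Ng)))

/-- The convex hull of the grid points. -/
def hull : Set (RSpace d) := convexHull ℝ (Set.range T.τ)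

/-- The vertices of the `n`-th simplex, as an affine basis of `ℝ^d`; its coordinates are the
barycentric coordinates of the simplex. -/
noncomputable def vertexBasis (n : Fin Ns) : AffineBasis (T.V n) ℝ (RSpace d) where
  toFun := fun i => T.τ i
  ind' := T.affineIndependent n
  tot' := by
    rw [(T.affineIndependent n).affineSpan_eq_top_iff_card_eq_finrank_add_one]
    simp [T.card_V n]

open Classical in
/-- The hat function `s_k`: on any simplex with vertex `k` it is the barycentric coordinate with
respect to that vertex, elsewhere it is zero. -/
noncomputable def hat (k : Fin Ng) (x : RSpace d) : ℝ :=
  if h : ∃ n, k ∈ T.V n ∧ x ∈ T.simplex n then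
    (T.vertexBasis h.choose).coord ⟨k, h.choose_spec.1⟩ x
  else 0

/-- The continuous piecewise-linear function `∑ k, c_k s_k` with grid-point values `c`. -/
noncomputable def fHull (c : Fin Ng → ℝ) (x : RSpace d) : ℝ := ∑ k, c k * T.hat k x

/-- The indices of the (unordered) pairs of neighboring simplices, i.e. of simplices whose
intersection is a facet, listed once each. -/
abbrev NeighborPair : Type :=
  {e : Fin Ns × Fin Ns // e.1 < e.2 ∧ (T.V e.1 ∩ T.V e.2).card = d}

variable {T}

theorem NeighborPair.card_sdiff_left (e : T.NeighborPair) :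
    (T.V e.1.1 \ T.V e.1.2).card = 1 := by
  have h := Finset.card_sdiff_add_card_inter (T.V e.1.1) (T.V e.1.2)
  rw [e.2.2, T.card_V] at h
  omega

theorem NeighborPair.card_sdiff_right (e : T.NeighborPair) :
    (T.V e.1.2 \ T.V e.1.1).card = 1 := by
  have h := Finset.card_sdiff_add_card_inter (T.V e.1.2) (T.V e.1.1)
  rw [Finset.inter_comm, e.2.2, T.card_V] at h
  omega

variable (T)

/-- For neighboring simplices `A`, `B`: the indices of the vertices `τ̃_0, τ̃_1, …, τ̃_{d+1}`,
where `τ̃_0` is the vertex of `A` that is not in `B`, then come the common vertices in increasing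
order of their indices, and `τ̃_{d+1}` is the vertex of `B` that is not in `A`. -/
noncomputable def idx (e : T.NeighborPair) : Fin (d + 2) → Fin Ng :=
  Fin.cons ((T.V e.1.1 \ T.V e.1.2).orderEmbOfFin e.card_sdiff_left 0)
    (Fin.snoc ((T.V e.1.1 ∩ T.V e.1.2).orderEmbOfFin e.2.2)
      ((T.V e.1.2 \ T.V e.1.1).orderEmbOfFin e.card_sdiff_right 0) : Fin (d + 1) → Fin Ng)

/-- The points `τ̃_0, …, τ̃_{d+1}`. -/
noncomputable def tau (e : T.NeighborPair) (p : Fin (d + 2)) : RSpace d := T.τ (T.idx e p)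

/-- `G_A`, the inverse of the matrix with rows `(τ̃_0 - τ̃_l)ᵀ`, `l = 1, …, d`. -/
noncomputable def GA (e : T.NeighborPair) : Matrix (Fin d) (Fin d) ℝ :=
  (Matrix.of fun l j : Fin d => T.tau e 0 j - T.tau e l.castSucc.succ j)⁻¹

/-- `G_B`, the inverse of the matrix with rows `(τ̃_{d+1} - τ̃_l)ᵀ`, `l = 1, …, d`. -/
noncomputable def GB (e : T.NeighborPair) : Matrix (Fin d) (Fin d) ℝ :=
  (Matrix.of fun l j : Fin d => T.tau e (Fin.last (d + 1)) j - T.tau e l.castSucc.succ j)⁻¹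

/-- The binary matrix `W_{A,B}`, with `w_{p,k} = 1` iff `τ̃_p = τ_k`. -/
noncomputable def W (e : T.NeighborPair) : Matrix (Fin (d + 2)) (Fin Ng) ℝ :=
  Matrix.of fun p k => if T.idx e p = k then 1 else 0

/-- The gradient-difference matrix
`G_{A,B} = [G_A 𝟏 | G_B - G_A | -G_B 𝟏] W_{A,B}`. -/
noncomputable def G (e : T.NeighborPair) : Matrix (Fin d) (Fin Ng) ℝ :=
  (Matrix.of fun i : Fin d =>
    (Fin.cons ((T.GA e *ᵥ 1) i)
      (Fin.snoc ((T.GB e - T.GA e) i) (-(T.GB e *ᵥ 1) i) : Fin (d + 1) → ℝ) :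
        Fin (d + 2) → ℝ)) * T.W e

/-- The matrix `N`, inverse of the matrix with rows `(τ̃_pᵀ, 1)`, `p = 0, …, d`. -/
noncomputable def N (e : T.NeighborPair) : Matrix (Fin (d + 1)) (Fin (d + 1)) ℝ :=
  (Matrix.of fun p : Fin (d + 1) =>
    (Fin.snoc (fun j : Fin d => T.tau e p.castSucc j) 1 : Fin (d + 1) → ℝ))⁻¹

/-- The first `d` entries of the first column of `N`. -/
noncomputable def normalVec (e : T.NeighborPair) : RSpace d :=
  WithLp.toLp 2 fun i : Fin d => T.N e i.castSucc 0

/-- The unit normal `u_{A,B}` of the common facet. -/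
noncomputable def u (e : T.NeighborPair) : RSpace d := ‖T.normalVec e‖⁻¹ • T.normalVec e

/-- `Vol_{A,B}`, the `(d-1)`-dimensional Euclidean volume of the intersection of the simplices
`A` and `B`. -/
noncomputable def Vol (e : T.NeighborPair) : ℝ :=
  (μHE[d - 1] (T.simplex e.1.1 ∩ T.simplex e.1.2)).toReal

/-- The row vector `R_{A,B} = Vol_{A,B} u_{A,B}ᵀ G_{A,B}`. -/
noncomputable def R (e : T.NeighborPair) : Fin Ng → ℝ :=
  T.Vol e • ((fun i => T.u e i) ᵥ* T.G e)

/-- The regularization operator `L`, whose rows are the `R_{A,B}`. -/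
noncomputable def L : Matrix T.NeighborPair (Fin Ng) ℝ := Matrix.of T.R

/-- The forward operator of the data points `x`, with entries `s_k(x_m)`. -/
noncomputable def H {M : ℕ} (x : Fin M → RSpace d) : Matrix (Fin M) (Fin Ng) ℝ :=
  Matrix.of fun m k => T.hat k (x m)

/-- The objective `∑ m, ½ (y_m - f(x_m))² + lam · HTV(f)` of the HTV-regularized least-squares
problem on the domain `Hull` (its interior, for the HTV). -/
noncomputable def htvObjective {M : ℕ} (x : Fin M → RSpace d) (y : Fin M → ℝ) (lam : ℝ)
    (f : RSpace d → ℝ) : EReal :=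
  ((∑ m, (1 / 2) * (y m - f (x m)) ^ 2 : ℝ) : EReal) + (lam : EReal) * HTV (interior T.hull) f

/-- The generalized LASSO objective `½ ‖y - H c‖₂² + lam ‖L c‖₁`. -/
noncomputable def lassoObjective {M : ℕ} (x : Fin M → RSpace d) (y : Fin M → ℝ) (lam : ℝ)
    (c : Fin Ng → ℝ) : ℝ :=
  (1 / 2) * ‖WithLp.toLp 2 (y - T.H x *ᵥ c)‖ ^ 2 + lam * ‖WithLp.toLp 1 (T.L *ᵥ c)‖

end GridTriangulation

open Filter Topology
open scoped RealInnerProductSpace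

/-! The function `fHull c` is continuous and affine on each simplex, so its distributional Hessian
is carried by the facets where two simplices meet. Integrating by parts twice on every simplex
(`integral_openSimplex_lineDeriv`) leaves only facet integrals. Facets on the boundary of the hull
miss the support of the test function. Every other facet belongs to exactly two simplices, with
opposite normals. The two affine pieces agree there, so the terms with a derivative of the test
function cancel, and the jump of the gradient is a multiple of the unit normal `ν`. Hence the
Hessian is the sum over common facets of the jump times `ν ⊗ ν` times surface measure
(`hessianPairing_fHull`).

The total variation now follows by duality. Since `‖F x‖ ≤ 1` gives `|νᵀ F ν| ≤ 1`, the supremum is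
at most the sum of |jump| times area. Conversely, the facets are pairwise disjoint once their
relative boundaries are removed; disjoint bumps on large compact parts of them, multiplied by
sign(jump) `ν ⊗ ν`, form an admissible test function that almost attains this sum
(`exists_admissible_ge`).

It remains to recognize the matrices: `G e *ᵥ c` is the jump of the gradient (`G_mulVec`), `u e` is
the normal (`u_eq`) and `Vol e` is the area of the relatively open facet (`Vol_eq`), so `R e ⬝ᵥ c`
is area times jump. The LASSO statement is this identity plus the fidelity term.

The analytic input is a divergence theorem on polyhedra (`integral_polyhedron_fderiv`), obtained by
replacing the indicator function with a product of steep smooth steps, whose gradient concentrates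
on the facets. -/

/-! ### Affine functions and their gradients -/

/-- The gradient of an affine function on `ℝ^d`. -/
noncomputable def affGrad {d : ℕ} (a : RSpace d →ᵃ[ℝ] ℝ) : RSpace d :=
  (InnerProductSpace.toDual ℝ (RSpace d)).symm (LinearMap.toContinuousLinearMap a.linear)

theorem inner_affGrad {d : ℕ} (a : RSpace d →ᵃ[ℝ] ℝ) (v : RSpace d) :
    ⟪affGrad a, v⟫ = a.linear v := by
  simp [affGrad]

theorem AffineMap.map_add_real {d : ℕ} (a : RSpace d →ᵃ[ℝ] ℝ) (x v : RSpace d) :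
    a (x + v) = a x + ⟪affGrad a, v⟫ := by
  rw [inner_affGrad, add_comm x v, ← vadd_eq_add, a.map_vadd, vadd_eq_add, add_comm]

theorem AffineMap.eq_inner_add {d : ℕ} (a : RSpace d →ᵃ[ℝ] ℝ) (x : RSpace d) :
    a x = a 0 + ⟪affGrad a, x⟫ := by
  simpa using a.map_add_real 0 x

theorem AffineMap.hasFDerivAt_real {d : ℕ} (a : RSpace d →ᵃ[ℝ] ℝ) (x : RSpace d) :
    HasFDerivAt a (innerSL ℝ (affGrad a)) x := by
  have h : (a : RSpace d → ℝ) = fun x => a 0 + innerSL ℝ (affGrad a) x := by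
    ext x; simpa using a.eq_inner_add x
  rw [h]
  exact ((innerSL ℝ (affGrad a)).hasFDerivAt).const_add _

theorem AffineMap.contDiff_real {d : ℕ} (a : RSpace d →ᵃ[ℝ] ℝ) {n : WithTop ℕ∞} :
    ContDiff ℝ n a := by
  have h : (a : RSpace d → ℝ) = fun x => a 0 + innerSL ℝ (affGrad a) x := by
    ext x; simpa using a.eq_inner_add x
  rw [h]
  fun_prop

theorem AffineMap.continuous_real {d : ℕ} (a : RSpace d →ᵃ[ℝ] ℝ) : Continuous a :=
  (a.contDiff_real (n := 0)).continuous

/-! ### Isometric charts of hyperplanes -/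

/-- An orthonormal frame with a given last vector splits Lebesgue measure. -/
theorem exists_linearIsometry_measurePreserving {d : ℕ} (u : RSpace (d + 1)) (hu : ‖u‖ = 1) :
    ∃ Φ : RSpace d →ₗᵢ[ℝ] RSpace (d + 1), Set.range Φ = {x | ⟪u, x⟫ = 0} ∧
      MeasurePreserving (fun z : RSpace d × ℝ => Φ z.1 + z.2 • u)
        ((volume : Measure (RSpace d)).prod volume) volume := by
  obtain ⟨b, hb⟩ := Orthonormal.exists_orthonormalBasis_extension_of_card_eq (𝕜 := ℝ)
    (E := RSpace (d + 1)) (ι := Fin (d + 1)) (by simp) (v := fun _ => u) (s := {0})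
    (by
      rw [orthonormal_iff_ite]
      rintro ⟨i, rfl⟩ ⟨j, rfl⟩
      simp [hu])
  have hb0 : b 0 = u := hb 0 rfl
  let ins : RSpace d →ₗᵢ[ℝ] RSpace (d + 1) :=
    { toFun := fun y => WithLp.toLp 2 (Fin.cons 0 y : Fin (d + 1) → ℝ)
      map_add' := fun x y => by
        ext i; refine Fin.cases ?_ (fun j => ?_) i <;> simp
      map_smul' := fun c y => by
        ext i; refine Fin.cases ?_ (fun j => ?_) i <;> simp
      norm_map' := fun y => by
        simp [EuclideanSpace.norm_eq, Fin.sum_univ_succ] }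
  have hins0 : ∀ y, ins y 0 = 0 := fun y => by simp [ins]
  have hinsS : ∀ y (j : Fin d), ins y j.succ = y j := fun y j => by simp [ins]
  refine ⟨b.repr.symm.toLinearIsometry.comp ins, ?_, ?_⟩
  · ext x
    simp only [Set.mem_range, Set.mem_ofPred_eq]
    rw [← hb0, ← b.repr_apply_apply]
    constructor
    · rintro ⟨y, rfl⟩
      simp [hins0]
    · intro hx
      refine ⟨WithLp.toLp 2 fun j => b.repr x j.succ, ?_⟩
      simp only [LinearIsometry.coe_comp, Function.comp_apply,
        LinearIsometryEquiv.coe_toLinearIsometry]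
      rw [LinearIsometryEquiv.symm_apply_eq]
      ext i
      refine Fin.cases ?_ (fun j => ?_) i
      · rw [hins0, hx]
      · rw [hinsS]
  -- The map is a composition of measure-preserving ones: swap the factors, insert the scalar as
  -- coordinate 0, pass to the Euclidean space, and apply the isometry given by `b`.
  · have h1 := b.measurePreserving_repr_symm
    have h2 := (EuclideanSpace.volume_preserving_symm_measurableEquiv_toLp (Fin (d + 1))).symm
    have h3 := (volume_preserving_piFinSuccAbove (fun _ : Fin (d + 1) => ℝ) 0).symm
    have h4 : MeasurePreserving (fun z : RSpace d × ℝ => (z.2, (WithLp.ofLp z.1 : Fin d → ℝ)))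
        ((volume : Measure (RSpace d)).prod volume)
        ((volume : Measure ℝ).prod (volume : Measure (Fin d → ℝ))) :=
      ((MeasurePreserving.id _).prod (PiLp.volume_preserving_ofLp (Fin d))).comp
        Measure.measurePreserving_swap
    have := h1.comp (h2.comp (h3.comp h4))
    convert this using 1
    ext1 z
    simp only [Function.comp_apply, LinearIsometry.coe_comp,
        LinearIsometryEquiv.coe_toLinearIsometry]
    rw [← hb0, ← LinearIsometryEquiv.symm_apply_apply b.repr (b 0), ← map_smul, ← map_add]
    congr 1
    ext i
    refine Fin.cases ?_ (fun j => ?_) i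
    · simp [hins0]
    · simp [hinsS]

/-- A chart of the zero hyperplane of an affine function. -/
theorem exists_hyperplane_chart {d : ℕ} (a : RSpace (d + 1) →ᵃ[ℝ] ℝ) (ha : affGrad a ≠ 0) :
    ∃ ψ : RSpace d →ᵃⁱ[ℝ] RSpace (d + 1), Set.range ψ = {x | a x = 0} ∧
      MeasurePreserving (fun z : RSpace d × ℝ => ψ z.1 + z.2 • (‖affGrad a‖⁻¹ • affGrad a))
        ((volume : Measure (RSpace d)).prod volume) volume ∧
      Measure.map ψ volume = μHE[d].restrict {x | a x = 0} := by
  set w := affGrad a with hw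
  have hw0 : ‖w‖ ≠ 0 := norm_ne_zero_iff.2 ha
  obtain ⟨Φ, hΦ, hmp⟩ := exists_linearIsometry_measurePreserving (‖w‖⁻¹ • w)
    (by simp [norm_smul, hw0])
  -- The foot of the perpendicular from the origin to the hyperplane.
  set p : RSpace (d + 1) := -(a 0 / ‖w‖ ^ 2) • w with hp
  have hap : a p = 0 := by
    rw [a.eq_inner_add, ← hw, hp, inner_smul_right, real_inner_self_eq_norm_sq]
    field_simp; ring
  let ψ : RSpace d →ᵃⁱ[ℝ] RSpace (d + 1) :=
    (AffineIsometryEquiv.vaddConst ℝ p).toAffineIsometry.comp Φ.toAffineIsometry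
  have hψ : ∀ y, ψ y = p + Φ y := fun y => by simp [ψ, add_comm]
  have hr : Set.range ψ = {x | a x = 0} := by
    ext x
    simp only [Set.mem_range, hψ, Set.mem_ofPred_eq]
    have : x - p ∈ Set.range Φ ↔ a x = 0 := by
      rw [hΦ, Set.mem_ofPred_eq, inner_smul_left]
      have := a.map_add_real p (x - p)
      rw [add_sub_cancel, hap, zero_add, ← hw] at this
      rw [this]; simp [hw0]
    rw [← this]
    simp only [Set.mem_range, eq_sub_iff_add_eq, add_comm]
  refine ⟨ψ, hr, ?_, ?_⟩
  · have := (measurePreserving_add_left volume p).comp hmp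
    convert this using 1
    ext1 z
    simp [hψ, add_assoc]
  -- `μHE[d]` is Lebesgue measure on `ℝ^d` and is transported by isometries.
  · rw [← EuclideanSpace.euclideanHausdorffMeasure_eq_volume, ← hr]
    exact ψ.isometry.map_euclideanHausdorffMeasure

/-! ### Thin smooth layers along a facet -/

theorem continuous_deriv_smoothTransition : Continuous (deriv Real.smoothTransition) :=
  (Real.smoothTransition.contDiff (n := 1)).continuous_deriv le_rfl

theorem deriv_smoothTransition_eq_zero {s : ℝ} (hs : s ∉ Set.Icc (0 : ℝ) 1) :
    deriv Real.smoothTransition s = 0 := by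
  rw [Set.mem_Icc, not_and_or, not_le, not_le] at hs
  rcases hs with hs | hs
  · have : Real.smoothTransition =ᶠ[𝓝 s] fun _ => 0 :=
      (eventually_lt_nhds hs).mono fun t ht => Real.smoothTransition.zero_of_nonpos ht.le
    rw [this.deriv_eq]; simp
  · have : Real.smoothTransition =ᶠ[𝓝 s] fun _ => 1 :=
      (eventually_gt_nhds hs).mono fun t ht => Real.smoothTransition.one_of_one_le ht.le
    rw [this.deriv_eq]; simp

theorem integral_deriv_smoothTransition : ∫ s, deriv Real.smoothTransition s = 1 := by
  have h : ∫ s, deriv Real.smoothTransition s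
      = ∫ s in Set.Icc (0 : ℝ) 1, deriv Real.smoothTransition s :=
    (setIntegral_eq_integral_of_forall_compl_eq_zero
      fun s hs => deriv_smoothTransition_eq_zero hs).symm
  rw [h, integral_Icc_eq_integral_Ioc, ← intervalIntegral.integral_of_le zero_le_one,
    intervalIntegral.integral_deriv_eq_sub]
  · simp
  · intro x _
    exact (Real.smoothTransition.contDiffAt (n := 1)).differentiableAt (by simp)
  · exact continuous_deriv_smoothTransition.intervalIntegrable _ _

theorem exists_bound_deriv_smoothTransition : ∃ C, ∀ s, |deriv Real.smoothTransition s| ≤ C := by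
  obtain ⟨C, hC⟩ := isCompact_Icc.exists_bound_of_continuousOn (s := Set.Icc (0 : ℝ) 1)
    continuous_deriv_smoothTransition.continuousOn
  refine ⟨max C 0, fun s => ?_⟩
  by_cases hs : s ∈ Set.Icc (0 : ℝ) 1
  · exact (hC s hs).trans (le_max_left _ _)
  · rw [deriv_smoothTransition_eq_zero hs]; simp

/-- Rescaling of the second variable in an integral over a product. -/
theorem integral_prod_scale {d : ℕ} (g : RSpace d × ℝ → ℝ) {c : ℝ} (hc : 0 < c) :
    ∫ z, g z ∂((volume : Measure (RSpace d)).prod volume) =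
      c * ∫ z, g (z.1, c * z.2) ∂((volume : Measure (RSpace d)).prod volume) := by
  have hm : Measure.map (Prod.map id (c * ·)) ((volume : Measure (RSpace d)).prod (volume : Measure ℝ))
      = ENNReal.ofReal c⁻¹ • (volume : Measure (RSpace d)).prod (volume : Measure ℝ) := by
    rw [← Measure.map_prod_map _ _ measurable_id (measurable_const_mul c), Measure.map_id,
      Real.map_volume_mul_left hc.ne', Measure.prod_smul_right, abs_of_pos (inv_pos.2 hc)]
  have he : MeasurableEmbedding (Prod.map id (c * ·) : RSpace d × ℝ → RSpace d × ℝ) :=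
    ((Homeomorph.refl (RSpace d)).prodCongr (Homeomorph.mulLeft₀ c hc.ne')).measurableEmbedding
  have h := he.integral_map (μ := (volume : Measure (RSpace d)).prod (volume : Measure ℝ)) g
  rw [hm, integral_smul_measure, ENNReal.toReal_ofReal (inv_pos.2 hc).le] at h
  have h2 : ∫ z, g (z.1, c * z.2) ∂((volume : Measure (RSpace d)).prod volume) = c⁻¹ • 
    ∫ z, g z ∂((volume : Measure (RSpace d)).prod volume) := by rw [h]; rfl
  rw [h2, smul_eq_mul, mul_inv_cancel_left₀ hc.ne']

/-- The steep step is constant outside a shrinking layer, so both limits are reached after finitely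
many terms. Nothing is said for `c₀ = 0`; that case will only occur on a null set. -/
theorem tendsto_smoothTransition_layer {c : ℕ → ℝ} {c₀ : ℝ} (hc : Tendsto c atTop (𝓝 c₀)) :
    (0 < c₀ → ∀ᶠ n : ℕ in atTop, Real.smoothTransition (((n : ℝ) + 1) * c n) = 1) ∧
    (c₀ < 0 → ∀ᶠ n : ℕ in atTop, Real.smoothTransition (((n : ℝ) + 1) * c n) = 0) := by
  constructor
  · intro h0
    have : Tendsto (fun n : ℕ => ((n : ℝ) + 1) * c n) atTop atTop :=
      (tendsto_natCast_atTop_atTop.atTop_add tendsto_const_nhds).atTop_mul_pos h0 hc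
    filter_upwards [this.eventually_ge_atTop 1] with n hn
    exact Real.smoothTransition.one_of_one_le hn
  · intro h0
    filter_upwards [hc.eventually_lt_const h0] with n hn
    exact Real.smoothTransition.zero_of_nonpos
      (mul_nonpos_of_nonneg_of_nonpos (by positivity) hn.le)

/-- Concentration of a thin smooth layer on a facet of a polyhedron. -/
theorem tendsto_integral_layer {d : ℕ} {ι : Type*} [Fintype ι] [DecidableEq ι]
    (l : ι → RSpace (d + 1) →ᵃ[ℝ] ℝ) (i : ι) (hi : affGrad (l i) ≠ 0)
    (hnull : ∀ j, j ≠ i → μHE[d] {x | l i x = 0 ∧ l j x = 0} = 0)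
    {φ : RSpace (d + 1) → ℝ} (hφ : Continuous φ) (hφc : HasCompactSupport φ) :
    Tendsto (fun n : ℕ => ∫ x, ((n : ℝ) + 1) * deriv Real.smoothTransition ((n + 1) * l i x) *
        (∏ j ∈ Finset.univ.erase i, Real.smoothTransition ((n + 1) * l j x)) * φ x) atTop
      (𝓝 (‖affGrad (l i)‖⁻¹ *
        ∫ x in {x | l i x = 0 ∧ ∀ j, j ≠ i → 0 < l j x}, φ x ∂μHE[d])) := by
  classical
  obtain ⟨ψ, hr, hmp, hmap⟩ := exists_hyperplane_chart (l i) hi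
  set w := affGrad (l i) with hw
  set u := ‖w‖⁻¹ • w with hu
  have hw0 : 0 < ‖w‖ := norm_pos_iff.2 hi
  have hu1 : ‖u‖ = 1 := by simp [hu, norm_smul, hw0.ne']
  have hlu : ∀ y (t : ℝ), l i (ψ y + t • u) = t * ‖w‖ := by
    intro y t
    have h0 : l i (ψ y) = 0 := by
      have : ψ y ∈ Set.range ψ := ⟨y, rfl⟩
      rwa [hr] at this
    rw [AffineMap.map_add_real, h0, ← hw, inner_smul_right, hu, inner_smul_right,
      real_inner_self_eq_norm_sq]
    field_simp; ring
  set S : Set (RSpace (d + 1)) := {x | l i x = 0 ∧ ∀ j, j ≠ i → 0 < l j x} with hS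
  set P : Set (RSpace d) := {y | ∀ j, j ≠ i → 0 < l j (ψ y)} with hP
  have hPS : ψ ⁻¹' S = P := by
    ext y
    have := hlu y 0
    simp only [zero_smul, add_zero, zero_mul] at this
    simp [hS, hP, this]
  have hSsub : S ⊆ {x | l i x = 0} := fun x hx => hx.1
  have hPo : IsOpen P := by
    have : P = ⋂ j, {y | j ≠ i → 0 < l j (ψ y)} := by ext; simp [hP]
    rw [this]
    refine isOpen_iInter_of_finite fun j => ?_
    by_cases hj : j = i
    · simp [hj]
    · simp only [ne_eq, hj, not_false_eq_true, forall_const]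
      exact isOpen_lt continuous_const ((l j).continuous_real.comp ψ.continuous)
  have hemb : MeasurableEmbedding ψ :=
    ψ.isometry.isClosedEmbedding.measurableEmbedding
  have hfacet : ∫ x in S, φ x ∂μHE[d] = ∫ y in P, φ (ψ y) := by
    rw [← hPS, ← hemb.setIntegral_map, hmap, Measure.restrict_restrict_of_subset hSsub]
  -- Where some other `l j` vanishes on the hyperplane, the pointwise limit is not determined; by
  -- `hnull` this is negligible.
  have hae : ∀ᵐ y : RSpace d, ∀ j, j ≠ i → l j (ψ y) ≠ 0 := by
    rw [ae_all_iff]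
    intro j
    by_cases hj : j = i
    · simp [hj]
    simp only [ne_eq, hj, not_false_eq_true, forall_const]
    rw [ae_iff]
    simp only [not_not]
    have h1 : volume (ψ ⁻¹' {x | l j x = 0}) = 0 := by
      rw [← hemb.map_apply, hmap, Measure.restrict_apply
        ((isClosed_eq (l j).continuous_real continuous_const).measurableSet)]
      convert hnull j hj using 2
      ext x; simp [and_comm]
    exact h1
  obtain ⟨C, hC⟩ := exists_bound_deriv_smoothTransition
  obtain ⟨M, hM⟩ := hφc.exists_bound_of_continuous hφ
  obtain ⟨R, hR⟩ := hφc.isCompact.isBounded.exists_norm_le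
  -- the rescaled integrands
  let t : ℕ → ℝ → ℝ := fun n s => ((n : ℝ) + 1)⁻¹ * ‖w‖⁻¹ * s
  let F : ℕ → RSpace d × ℝ → ℝ := fun n z =>
    deriv Real.smoothTransition z.2 *
      (∏ j ∈ Finset.univ.erase i,
        Real.smoothTransition ((n + 1) * l j (ψ z.1 + t n z.2 • u))) *
      φ (ψ z.1 + t n z.2 • u)
  have hFeq : ∀ n : ℕ, ∫ x, ((n : ℝ) + 1) * deriv Real.smoothTransition ((n + 1) * l i x) *
        (∏ j ∈ Finset.univ.erase i, Real.smoothTransition ((n + 1) * l j x)) * φ x =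
      ‖w‖⁻¹ * ∫ z, F n z ∂((volume : Measure (RSpace d)).prod volume) := by
    intro n
    have hn : (0 : ℝ) < n + 1 := by positivity
    have hcont : Continuous fun x => ((n : ℝ) + 1) * deriv Real.smoothTransition ((n + 1) * l i x) *
        (∏ j ∈ Finset.univ.erase i, Real.smoothTransition ((n + 1) * l j x)) * φ x := by
      have h1 := continuous_deriv_smoothTransition.comp
        (continuous_const.mul (l i).continuous_real : Continuous fun x => ((n : ℝ) + 1) * l i x)
      have h2 : Continuous fun x => ∏ j ∈ Finset.univ.erase i,
          Real.smoothTransition (((n : ℝ) + 1) * l j x) :=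
        continuous_finsetProd _ fun j _ => Real.smoothTransition.continuous.comp
          (continuous_const.mul (l j).continuous_real)
      exact ((continuous_const.mul h1).mul h2).mul hφ
    rw [← hmp.map_eq, integral_map hmp.measurable.aemeasurable hcont.aestronglyMeasurable,
      integral_prod_scale _ (c := ((n : ℝ) + 1)⁻¹ * ‖w‖⁻¹) (by positivity)]
    rw [mul_comm ((n : ℝ) + 1)⁻¹, mul_assoc, ← integral_const_mul]
    congr 2
    ext1 z
    simp only [F, t, hlu]
    have : ((n : ℝ) + 1) * (‖w‖⁻¹ * ((n : ℝ) + 1)⁻¹ * z.2 * ‖w‖) = z.2 := by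
      field_simp
    rw [this, mul_comm ‖w‖⁻¹ ((n : ℝ) + 1)⁻¹]
    simp only [mul_assoc]
    rw [inv_mul_cancel_left₀ hn.ne']
  have ht : ∀ s, Tendsto (fun n => t n s) atTop (𝓝 0) := by
    intro s
    have := (tendsto_one_div_add_atTop_nhds_zero_nat (𝕜 := ℝ)).mul_const (‖w‖⁻¹ * s)
    simpa [t, mul_assoc] using this
  have hmain : Tendsto (fun n => ∫ z, F n z ∂((volume : Measure (RSpace d)).prod volume)) atTop
      (𝓝 (∫ z, deriv Real.smoothTransition z.2 * P.indicator (fun y => φ (ψ y)) z.1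
        ∂((volume : Measure (RSpace d)).prod volume))) := by
    -- The integrand lives on a fixed box: `s ∈ [0, 1]` by the support of the derivative, and the
    -- radius adds the bound `R` on the support of `φ`, the offset `‖ψ 0‖` of the chart and the
    -- largest height `‖w‖⁻¹`.
    refine tendsto_integral_of_dominated_convergence
      (fun z => (Metric.closedBall (0 : RSpace d) (R + ‖ψ 0‖ + ‖w‖⁻¹) ×ˢ
        Set.Icc (0 : ℝ) 1).indicator (fun _ => C * M) z) ?_ ?_ ?_ ?_
    · intro n
      refine Continuous.aestronglyMeasurable ?_
      have h0 : Continuous fun z : RSpace d × ℝ => ψ z.1 + t n z.2 • u := by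
        have := ψ.continuous
        fun_prop
      have h1 : Continuous fun z : RSpace d × ℝ => deriv Real.smoothTransition z.2 :=
        continuous_deriv_smoothTransition.comp continuous_snd
      have h2 : Continuous fun z : RSpace d × ℝ => ∏ j ∈ Finset.univ.erase i,
          Real.smoothTransition (((n : ℝ) + 1) * l j (ψ z.1 + t n z.2 • u)) :=
        continuous_finsetProd _ fun j _ => Real.smoothTransition.continuous.comp
          (continuous_const.mul ((l j).continuous_real.comp h0))
      exact (h1.mul h2).mul (hφ.comp h0)
    · refine (integrable_indicator_iff
        (measurableSet_closedBall.prod measurableSet_Icc)).2 ?_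
      refine integrableOn_const ?_
      rw [Measure.prod_prod]
      exact ENNReal.mul_ne_top (isCompact_closedBall _ _).measure_lt_top.ne
        isCompact_Icc.measure_lt_top.ne
    · intro n
      refine Eventually.of_forall fun z => ?_
      have hM0 : 0 ≤ M := (norm_nonneg _).trans (hM 0)
      have hC0 : 0 ≤ C := (abs_nonneg _).trans (hC 0)
      by_cases hz : z ∈ Metric.closedBall (0 : RSpace d) (R + ‖ψ 0‖ + ‖w‖⁻¹) ×ˢ Set.Icc (0 : ℝ) 1
      · rw [Set.indicator_of_mem hz]
        simp only [F, norm_mul]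
        have hp : ‖∏ j ∈ Finset.univ.erase i,
            Real.smoothTransition (((n : ℝ) + 1) * l j (ψ z.1 + t n z.2 • u))‖ ≤ 1 := by
          rw [norm_prod]
          refine Finset.prod_le_one (fun _ _ => norm_nonneg _) fun j _ => ?_
          rw [Real.norm_of_nonneg (Real.smoothTransition.nonneg _)]
          exact Real.smoothTransition.le_one _
        have h1 : ‖deriv Real.smoothTransition z.2‖ ≤ C := hC _
        calc _ ≤ C * 1 * M := by gcongr; exact hM _
          _ = C * M := by ring
      · rw [Set.indicator_of_notMem hz]
        refine le_of_eq (norm_eq_zero.2 ?_)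
        by_cases hz2 : z.2 ∈ Set.Icc (0 : ℝ) 1
        · have hφ0 : φ (ψ z.1 + t n z.2 • u) = 0 := by
            by_contra hne
            apply hz
            refine ⟨?_, hz2⟩
            have hx := hR _ (subset_tsupport φ hne)
            rw [mem_closedBall_zero_iff]
            have h1 : ‖z.1‖ = ‖ψ z.1 - ψ 0‖ := by
              rw [← dist_eq_norm, ψ.dist_map, dist_zero_right]
            have ht1 : ‖t n z.2 • u‖ ≤ ‖w‖⁻¹ := by
              rw [norm_smul, hu1, mul_one, Real.norm_of_nonneg
                (mul_nonneg (by positivity) hz2.1)]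
              have : ((n : ℝ) + 1)⁻¹ ≤ 1 := inv_le_one_of_one_le₀ (by linarith [n.cast_nonneg (α := ℝ)])
              calc ((n : ℝ) + 1)⁻¹ * ‖w‖⁻¹ * z.2 ≤ 1 * ‖w‖⁻¹ * 1 := by
                    gcongr
                    · exact hz2.1
                    · exact hz2.2
                _ = ‖w‖⁻¹ := by ring
            have h2 : ψ z.1 - ψ 0 = (ψ z.1 + t n z.2 • u) - ψ 0 - t n z.2 • u := by abel
            rw [h1, h2]
            refine (norm_sub_le _ _).trans (add_le_add ((norm_sub_le _ _).trans ?_) ht1)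
            gcongr
          simp [F, hφ0]
        · simp [F, deriv_smoothTransition_eq_zero hz2]
    · have hae2 : ∀ᵐ z ∂((volume : Measure (RSpace d)).prod (volume : Measure ℝ)),
          ∀ j, j ≠ i → l j (ψ z.1) ≠ 0 :=
        Measure.quasiMeasurePreserving_fst.ae hae
      filter_upwards [hae2] with z hz
      have hx : Tendsto (fun n => ψ z.1 + t n z.2 • u) atTop (𝓝 (ψ z.1)) := by
        have := ((ht z.2).smul_const u).const_add (ψ z.1)
        simpa using this
      have hlj : ∀ j, Tendsto (fun n => l j (ψ z.1 + t n z.2 • u)) atTop (𝓝 (l j (ψ z.1))) :=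
        fun j => ((l j).continuous_real.tendsto _).comp hx
      have hφt := (hφ.tendsto (ψ z.1)).comp hx
      have hprod : Tendsto (fun n : ℕ => ∏ j ∈ Finset.univ.erase i,
          Real.smoothTransition (((n : ℝ) + 1) * l j (ψ z.1 + t n z.2 • u))) atTop
          (𝓝 (P.indicator (fun _ => 1) z.1)) := by
        by_cases hzP : z.1 ∈ P
        · rw [Set.indicator_of_mem hzP]
          have h1 : (1 : ℝ) = ∏ _j ∈ Finset.univ.erase i, 1 := by simp
          rw [h1]
          refine tendsto_finsetProd _ fun j hj => ?_
          beta_reduce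
          rw [← h1]
          have hj := Finset.ne_of_mem_erase hj
          exact tendsto_nhds_of_eventually_eq
            ((tendsto_smoothTransition_layer (hlj j)).1 (hzP j hj))
        · rw [Set.indicator_of_notMem hzP]
          simp only [hP, Set.mem_ofPred_eq, not_forall, not_lt] at hzP
          obtain ⟨j, hj, hjl⟩ := hzP
          refine tendsto_nhds_of_eventually_eq ?_
          filter_upwards [(tendsto_smoothTransition_layer (hlj j)).2
            (lt_of_le_of_ne hjl (hz j hj))] with n hn
          exact Finset.prod_eq_zero (Finset.mem_erase.2 ⟨hj, Finset.mem_univ j⟩) hn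
      have := (hprod.const_mul (deriv Real.smoothTransition z.2)).mul hφt
      have h1 : deriv Real.smoothTransition z.2 * P.indicator (fun y => φ (ψ y)) z.1 =
          deriv Real.smoothTransition z.2 * P.indicator (fun _ => 1) z.1 * φ (ψ z.1) := by
        by_cases hzP : z.1 ∈ P <;> simp [hzP]
      rw [h1]
      exact this
  have hlim : ∫ z, deriv Real.smoothTransition z.2 * P.indicator (fun y => φ (ψ y)) z.1
        ∂((volume : Measure (RSpace d)).prod volume) = ∫ x in S, φ x ∂μHE[d] := by
    rw [hfacet]
    have := integral_prod_mul (μ := (volume : Measure (RSpace d))) (ν := (volume : Measure ℝ))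
      (P.indicator fun y => φ (ψ y)) (deriv Real.smoothTransition)
    rw [integral_deriv_smoothTransition, mul_one, integral_indicator hPo.measurableSet] at this
    rw [← this]
    simp only [mul_comm]
  rw [hlim] at hmain
  simp_rw [hFeq]
  exact hmain.const_mul _

/-! ### The divergence theorem on a polyhedron -/

/-- The divergence theorem on a polyhedron, for the derivative of a test function in one
direction. -/
theorem integral_polyhedron_fderiv {d : ℕ} {ι : Type*} [Fintype ι]
    (l : ι → RSpace (d + 1) →ᵃ[ℝ] ℝ) (hl : ∀ i, affGrad (l i) ≠ 0)
    (hnull : ∀ i j, j ≠ i → μHE[d] {x | l i x = 0 ∧ l j x = 0} = 0)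
    {φ : RSpace (d + 1) → ℝ} (hφ : ContDiff ℝ 1 φ) (hφc : HasCompactSupport φ)
    (v : RSpace (d + 1)) :
    ∫ x in {x | ∀ i, 0 < l i x}, fderiv ℝ φ x v =
      -∑ i, ⟪affGrad (l i), v⟫ * (‖affGrad (l i)‖⁻¹ *
        ∫ x in {x | l i x = 0 ∧ ∀ j, j ≠ i → 0 < l j x}, φ x ∂μHE[d]) := by
  classical
  set D : Set (RSpace (d + 1)) := {x | ∀ i, 0 < l i x} with hD
  have hDm : MeasurableSet D := by
    have : D = ⋂ i, {x | 0 < l i x} := by ext; simp [hD]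
    rw [this]
    exact (isOpen_iInter_of_finite fun i =>
      isOpen_lt continuous_const (l i).continuous_real).measurableSet
  -- A smooth approximation of the indicator of `D`; the `k i n` are the layers produced by
  -- differentiating its factors.
  let h : ℕ → RSpace (d + 1) → ℝ := fun n x =>
    ∏ j, Real.smoothTransition (((n : ℝ) + 1) * l j x)
  let k : ι → ℕ → RSpace (d + 1) → ℝ := fun i n x =>
    ((n : ℝ) + 1) * deriv Real.smoothTransition ((n + 1) * l i x) *
        (∏ j ∈ Finset.univ.erase i, Real.smoothTransition ((n + 1) * l j x)) * φ x
  have hk : ∀ i n, Continuous (k i n) := by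
    intro i n
    have h1 := continuous_deriv_smoothTransition.comp
      (continuous_const.mul (l i).continuous_real : Continuous fun x => ((n : ℝ) + 1) * l i x)
    have h2 : Continuous fun x => ∏ j ∈ Finset.univ.erase i,
        Real.smoothTransition (((n : ℝ) + 1) * l j x) :=
      continuous_finsetProd _ fun j _ => Real.smoothTransition.continuous.comp
        (continuous_const.mul (l j).continuous_real)
    exact ((continuous_const.mul h1).mul h2).mul hφ.continuous
  have hki : ∀ i n, Integrable (k i n) := fun i n =>
    (hk i n).integrable_of_hasCompactSupport hφc.mul_left
  have hhd : ∀ n x, HasFDerivAt (h n) (∑ i, (∏ j ∈ Finset.univ.erase i,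
      Real.smoothTransition (((n : ℝ) + 1) * l j x)) •
      ((deriv Real.smoothTransition (((n : ℝ) + 1) * l i x)) •
        (((n : ℝ) + 1) • innerSL ℝ (affGrad (l i))))) x := by
    intro n x
    refine HasFDerivAt.finsetProd fun i _ => ?_
    have h1 : HasDerivAt Real.smoothTransition (deriv Real.smoothTransition
        (((n : ℝ) + 1) * l i x)) (((n : ℝ) + 1) * l i x) :=
      ((Real.smoothTransition.contDiffAt (n := 1)).differentiableAt (by simp)).hasDerivAt
    exact h1.comp_hasFDerivAt x (((l i).hasFDerivAt_real x).const_mul _)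
  have hhc : ∀ n, Continuous (h n) := fun n =>
    continuous_finsetProd _ fun j _ => Real.smoothTransition.continuous.comp
        (continuous_const.mul (l j).continuous_real)
  have hder : ∀ n x, fderiv ℝ (h n) x v * φ x = ∑ i, ⟪affGrad (l i), v⟫ * k i n x := by
    intro n x
    rw [(hhd n x).fderiv]
    simp only [sum_apply, smul_apply, smul_eq_mul,
      innerSL_apply_apply, Finset.sum_mul, k]
    refine Finset.sum_congr rfl fun i _ => ?_
    ring
  have hφ'c : Continuous fun x => fderiv ℝ φ x v :=
    (hφ.continuous_fderiv one_ne_zero).clm_apply continuous_const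
  have hφ'cs : HasCompactSupport fun x => fderiv ℝ φ x v := hφc.fderiv_apply (𝕜 := ℝ) v
  have hibp : ∀ n, ∫ x, h n x * fderiv ℝ φ x v =
      -∑ i, ⟪affGrad (l i), v⟫ * ∫ x, k i n x := by
    intro n
    rw [integral_mul_fderiv_eq_neg_fderiv_mul_of_integrable]
    · simp_rw [hder]
      rw [integral_finsetSum _ fun i _ => (hki i n).const_mul _]
      simp_rw [integral_const_mul]
    · simp_rw [hder]
      exact integrable_finsetSum _ fun i _ => (hki i n).const_mul _
    · exact ((hhc n).mul hφ'c).integrable_of_hasCompactSupport hφ'cs.mul_left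
    · exact ((hhc n).mul hφ.continuous).integrable_of_hasCompactSupport hφc.mul_left
    · exact fun x _ => (hhd n x).differentiableAt
    · exact fun x _ => hφ.differentiable one_ne_zero x
  have hlim1 : Tendsto (fun n => ∫ x, h n x * fderiv ℝ φ x v) atTop
      (𝓝 (∫ x in D, fderiv ℝ φ x v)) := by
    rw [← integral_indicator hDm]
    refine tendsto_integral_of_dominated_convergence (fun x => ‖fderiv ℝ φ x v‖) ?_ ?_ ?_ ?_
    · exact fun n => ((hhc n).mul hφ'c).aestronglyMeasurable
    · exact (hφ'c.integrable_of_hasCompactSupport hφ'cs).norm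
    · refine fun n => Eventually.of_forall fun x => ?_
      rw [norm_mul]
      refine mul_le_of_le_one_left (norm_nonneg _) ?_
      rw [norm_prod]
      refine Finset.prod_le_one (fun _ _ => norm_nonneg _) fun j _ => ?_
      rw [Real.norm_of_nonneg (Real.smoothTransition.nonneg _)]
      exact Real.smoothTransition.le_one _
    -- Convergence holds at every point, without exceptional set: the step vanishes at all
    -- nonpositive arguments, so `h n` is exactly 0 outside the open set `D`.
    · refine Eventually.of_forall fun x => ?_
      refine tendsto_nhds_of_eventually_eq ?_
      by_cases hx : x ∈ D
      · have : ∀ᶠ n : ℕ in atTop, ∀ i, Real.smoothTransition (((n : ℝ) + 1) * l i x) = 1 :=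
          eventually_all.2 fun i =>
            (tendsto_smoothTransition_layer (c := fun _ => l i x) tendsto_const_nhds).1 (hx i)
        filter_upwards [this] with n hn
        simp [h, hn, Set.indicator_of_mem hx]
      · refine Eventually.of_forall fun n => ?_
        rw [Set.indicator_of_notMem hx]
        simp only [hD, Set.mem_ofPred_eq, not_forall, not_lt] at hx
        obtain ⟨i, hi⟩ := hx
        have : h n x = 0 := Finset.prod_eq_zero (Finset.mem_univ i)
          (Real.smoothTransition.zero_of_nonpos
            (mul_nonpos_of_nonneg_of_nonpos (by positivity) hi))
        rw [this, zero_mul]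
  have hlim2 : Tendsto (fun n => -∑ i, ⟪affGrad (l i), v⟫ * ∫ x, k i n x) atTop
      (𝓝 (-∑ i, ⟪affGrad (l i), v⟫ * (‖affGrad (l i)‖⁻¹ *
        ∫ x in {x | l i x = 0 ∧ ∀ j, j ≠ i → 0 < l j x}, φ x ∂μHE[d]))) :=
    (tendsto_finsetSum _ fun i _ => (tendsto_integral_layer l i (hl i) (hnull i)
      hφ.continuous hφc).const_mul _).neg
  simp_rw [hibp] at hlim1
  exact tendsto_nhds_unique hlim1 hlim2

/-! ### Barycentric expansions and null sets of affine functions -/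

theorem AffineMap.map_sum_real {d : ℕ} {ι : Type*} [Fintype ι] (a : RSpace d →ᵃ[ℝ] ℝ)
    (w : ι → ℝ) (hw : ∑ k, w k = 1) (p : ι → RSpace d) :
    a (∑ k, w k • p k) = ∑ k, w k * a (p k) := by
  rw [a.eq_inner_add, inner_sum]
  simp_rw [inner_smul_right, fun k => a.eq_inner_add (p k), mul_add, Finset.sum_add_distrib,
    ← Finset.sum_mul, hw, one_mul]

theorem AffineBasis.sum_coord_mul {d : ℕ} {ι : Type*} [Fintype ι] (b : AffineBasis ι ℝ (RSpace d))
    (a : RSpace d →ᵃ[ℝ] ℝ) (x : RSpace d) : a x = ∑ k, b.coord k x * a (b k) := by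
  rw [← a.map_sum_real _ (b.sum_coord_apply_eq_one x), b.linear_combination_coord_eq_self]

theorem affGrad_ne_zero {d : ℕ} {a : RSpace d →ᵃ[ℝ] ℝ} {x y : RSpace d} (h : a x ≠ a y) :
    affGrad a ≠ 0 := by
  intro h0
  apply h
  rw [a.eq_inner_add x, a.eq_inner_add y, h0]
  simp

/-- The zero set of a nonzero affine function is a null set. -/
theorem volume_affine_eq_zero {d : ℕ} (a : RSpace d →ᵃ[ℝ] ℝ) {p : RSpace d} (hp : a p ≠ 0) :
    volume {x | a x = 0} = 0 := by
  have h := Measure.addHaar_affineSubspace (volume : Measure (RSpace d))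
    ((AffineSubspace.mk' (0 : ℝ) ⊥).comap a) (fun h => by
      have : p ∈ (AffineSubspace.mk' (0 : ℝ) ⊥).comap a := h ▸ AffineSubspace.mem_top _ _ _
      rw [AffineSubspace.mem_comap, AffineSubspace.mem_mk'] at this
      simp at this
      exact hp this)
  convert h using 2
  ext x
  simp [AffineSubspace.mem_mk']

/-- The intersection of two different hyperplanes is negligible in each of them. -/
theorem euclideanHausdorffMeasure_inter_eq_zero {d : ℕ} {a b : RSpace (d + 1) →ᵃ[ℝ] ℝ}
    (ha : affGrad a ≠ 0) {p : RSpace (d + 1)} (hap : a p = 0) (hbp : b p ≠ 0) :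
    μHE[d] {x | a x = 0 ∧ b x = 0} = 0 := by
  obtain ⟨ψ, hr, -, hmap⟩ := exists_hyperplane_chart a ha
  have hemb : MeasurableEmbedding ψ := ψ.isometry.isClosedEmbedding.measurableEmbedding
  have h1 : μHE[d] {x | a x = 0 ∧ b x = 0} = volume (ψ ⁻¹' {x | b x = 0}) := by
    rw [← hemb.map_apply, hmap, Measure.restrict_apply
        ((isClosed_eq b.continuous_real continuous_const).measurableSet)]
    congr 1
    ext x; simp [and_comm]
  rw [h1]
  obtain ⟨y, rfl⟩ : p ∈ Set.range ψ := by rw [hr]; exact hap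
  exact volume_affine_eq_zero (b.comp ψ.toAffineMap) (p := y) (by simpa using hbp)

/-! ### Simplices, open facets and their incidence -/

namespace GridTriangulation

variable {d Ng Ns : ℕ} (T : GridTriangulation (d + 1) Ng Ns)

/-- The barycentric coordinates of a simplex. -/
noncomputable def lam (n : Fin Ns) (i : T.V n) : RSpace (d + 1) →ᵃ[ℝ] ℝ := (T.vertexBasis n).coord i

/-- The relatively open simplex. -/
def openSimplex (n : Fin Ns) : Set (RSpace (d + 1)) := {x | ∀ i, 0 < T.lam n i x}

/-- The relatively open facet of a simplex opposite to one of its vertices. -/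
def openFacet (n : Fin Ns) (i : T.V n) : Set (RSpace (d + 1)) :=
  {x | T.lam n i x = 0 ∧ ∀ j, j ≠ i → 0 < T.lam n j x}

@[simp] theorem vertexBasis_apply (n : Fin Ns) (i : T.V n) : T.vertexBasis n i = T.τ i := rfl

theorem lam_self (n : Fin Ns) (i : T.V n) : T.lam n i (T.τ i) = 1 :=
  (T.vertexBasis n).coord_apply_eq i

theorem lam_ne (n : Fin Ns) (i j : T.V n) (h : i ≠ j) : T.lam n i (T.τ j) = 0 :=
  (T.vertexBasis n).coord_apply_ne h

theorem sum_lam_mul (n : Fin Ns) (a : RSpace (d + 1) →ᵃ[ℝ] ℝ) (x : RSpace (d + 1)) :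
    a x = ∑ k : T.V n, T.lam n k x * a (T.τ k) :=
  (T.vertexBasis n).sum_coord_mul a x

theorem simplex_eq (n : Fin Ns) : T.simplex n = {x | ∀ i, 0 ≤ T.lam n i x} := by
  have : T.τ '' (T.V n : Set (Fin Ng)) = Set.range (T.vertexBasis n) := by
    ext x; simp
  rw [simplex, this]
  exact (T.vertexBasis n).convexHull_eq_nonneg_coord

theorem mem_simplex {n : Fin Ns} {x : RSpace (d + 1)} :
    x ∈ T.simplex n ↔ ∀ i, 0 ≤ T.lam n i x := by
  rw [T.simplex_eq]; rfl

theorem isClosed_simplex (n : Fin Ns) : IsClosed (T.simplex n) := by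
  have : T.simplex n = ⋂ i, {x | 0 ≤ T.lam n i x} := by ext; simp [T.simplex_eq]
  rw [this]
  exact isClosed_iInter fun i => isClosed_le continuous_const (T.lam n i).continuous_real

theorem isOpen_openSimplex (n : Fin Ns) : IsOpen (T.openSimplex n) := by
  have : T.openSimplex n = ⋂ i, {x | 0 < T.lam n i x} := by ext; simp [openSimplex]
  rw [this]
  exact isOpen_iInter_of_finite fun i => isOpen_lt continuous_const (T.lam n i).continuous_real

theorem measurableSet_openFacet (n : Fin Ns) (i : T.V n) : MeasurableSet (T.openFacet n i) := by
  have : T.openFacet n i = {x | T.lam n i x = 0} ∩ ⋂ j : {j // j ≠ i}, {x | 0 < T.lam n j x} := by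
    ext; simp [openFacet]
  rw [this]
  exact (isClosed_eq (T.lam n i).continuous_real continuous_const).measurableSet.inter
    (isOpen_iInter_of_finite fun j : {j // j ≠ i} =>
      isOpen_lt continuous_const (T.lam n j).continuous_real).measurableSet

theorem openFacet_subset_simplex (n : Fin Ns) (i : T.V n) : T.openFacet n i ⊆ T.simplex n := by
  intro x hx
  rw [T.mem_simplex]
  intro j
  by_cases h : j = i
  · rw [h, hx.1]
  · exact (hx.2 j h).le

theorem openSimplex_subset_simplex (n : Fin Ns) : T.openSimplex n ⊆ T.simplex n :=
  fun _ hx => T.mem_simplex.2 fun i => (hx i).le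

theorem hull_eq : T.hull = ⋃ n, T.simplex n := T.iUnion_simplex.symm

theorem simplex_subset_hull (n : Fin Ns) : T.simplex n ⊆ T.hull := by
  rw [T.hull_eq]; exact Set.subset_iUnion _ n

theorem exists_ne_index (n : Fin Ns) (i : T.V n) : ∃ j : T.V n, j ≠ i := by
  have : Nontrivial (T.V n) := by
    rw [← Fintype.one_lt_card_iff_nontrivial, Fintype.card_coe, T.card_V]; omega
  exact exists_ne i

theorem affGrad_lam_ne_zero (n : Fin Ns) (i : T.V n) : affGrad (T.lam n i) ≠ 0 := by
  obtain ⟨j, hj⟩ := T.exists_ne_index n i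
  refine affGrad_ne_zero (x := T.τ i) (y := T.τ j) ?_
  rw [T.lam_self, T.lam_ne n i j hj.symm]
  exact one_ne_zero

theorem facet_inter_null (n : Fin Ns) (i j : T.V n) (h : j ≠ i) :
    μHE[d] {x | T.lam n i x = 0 ∧ T.lam n j x = 0} = 0 :=
  euclideanHausdorffMeasure_inter_eq_zero (T.affGrad_lam_ne_zero n i) (T.lam_ne n i j h.symm)
    (by rw [T.lam_self]; exact one_ne_zero)

/-- Points of a common face have the same barycentric coordinates in both simplices. -/
theorem exists_weights {m n : Fin Ns} {x : RSpace (d + 1)} (hm : x ∈ T.simplex m)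
    (hn : x ∈ T.simplex n) :
    ∃ w : Fin Ng → ℝ, (∀ k, k ∉ T.V m ∩ T.V n → w k = 0) ∧
      (∀ i : T.V m, T.lam m i x = w i) ∧ ∀ i : T.V n, T.lam n i x = w i := by
  have hx : x ∈ convexHull ℝ (T.τ '' ((T.V m ∩ T.V n : Finset (Fin Ng)) : Set (Fin Ng))) :=
    T.inter_simplex m n ▸ ⟨hm, hn⟩
  have hmin : convexHull ℝ (T.τ '' ((T.V m ∩ T.V n : Finset (Fin Ng)) : Set (Fin Ng))) ⊆
      {x | ∃ w : Fin Ng → ℝ, (∀ k, k ∉ T.V m ∩ T.V n → w k = 0) ∧ ∑ k, w k = 1 ∧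
        x = ∑ k, w k • T.τ k} := by
    refine convexHull_min ?_ ?_
    · rintro _ ⟨k, hk, rfl⟩
      refine ⟨Pi.single k 1, fun k' hk' => ?_, by simp, ?_⟩
      · refine Pi.single_eq_of_ne ?_ _
        rintro rfl
        exact hk' hk
      · rw [Finset.sum_eq_single k] <;> simp +contextual
    · rintro _ ⟨w, hw, hw1, rfl⟩ _ ⟨w', hw', hw1', rfl⟩ a b ha hb hab
      refine ⟨a • w + b • w', fun k hk => by simp [hw k hk, hw' k hk], ?_, ?_⟩
      · simp [Finset.sum_add_distrib, ← Finset.mul_sum, hw1, hw1', hab]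
      · simp [add_smul, Finset.sum_add_distrib, Finset.smul_sum, mul_smul]
  obtain ⟨w, hw, hw1, rfl⟩ := hmin hx
  -- Weights carried by the common vertices are barycentric coordinates in either simplex, by
  -- uniqueness of the latter.
  have key : ∀ (n' : Fin Ns) (_ : T.V m ∩ T.V n ⊆ T.V n') (i : T.V n'),
      T.lam n' i (∑ k, w k • T.τ k) = w i := by
    intro n' hn' i
    rw [AffineMap.map_sum_real _ _ hw1, Finset.sum_eq_single (i : Fin Ng)]
    · rw [T.lam_self, mul_one]
    · intro k _ hk
      by_cases hkn : k ∈ T.V m ∩ T.V n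
      · rw [T.lam_ne n' i ⟨k, hn' hkn⟩ (fun h => hk (by rw [h])), mul_zero]
      · rw [hw k hkn, zero_mul]
    · simp
  exact ⟨w, hw, key m Finset.inter_subset_left, key n Finset.inter_subset_right⟩

/-- A point of both simplices lies in their common face, so its coordinates at all other vertices
vanish. The incidence results below are applications of this. -/
theorem mem_V_of_lam_pos {m n : Fin Ns} {x : RSpace (d + 1)} (hm : x ∈ T.simplex m)
    (hn : x ∈ T.simplex n) (i : T.V n) (hi : 0 < T.lam n i x) : (i : Fin Ng) ∈ T.V m := by
  obtain ⟨w, hw, -, h2⟩ := T.exists_weights hm hn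
  by_contra hc
  rw [h2, hw i (fun h => hc (Finset.mem_inter.1 h).1)] at hi
  exact lt_irrefl _ hi

/-- All coordinates are positive, so every vertex of one simplex is a vertex of the other, and both
have equally many. -/
theorem eq_of_mem_openSimplex {m n : Fin Ns} {x : RSpace (d + 1)} (hm : x ∈ T.simplex m)
    (hn : x ∈ T.openSimplex n) : m = n := by
  refine (T.V_injective (Finset.eq_of_subset_of_card_le (fun k hk => ?_) ?_)).symm
  · exact T.mem_V_of_lam_pos hm (T.openSimplex_subset_simplex n hn) ⟨k, hk⟩ (hn _)
  · rw [T.card_V, T.card_V]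

theorem erase_subset_of_mem_openFacet {m n : Fin Ns} {i : T.V n} {x : RSpace (d + 1)}
    (hx : x ∈ T.openFacet n i) (hm : x ∈ T.simplex m) : (T.V n).erase i ⊆ T.V m := by
  intro k hk
  rw [Finset.mem_erase] at hk
  exact T.mem_V_of_lam_pos hm (T.openFacet_subset_simplex n i hx) ⟨k, hk.2⟩
    (hx.2 _ fun h => hk.1 (by rw [← h]))

theorem exists_erase_eq {m n : Fin Ns} {i : T.V n} (h : (T.V n).erase i ⊆ T.V m) :
    ∃ j : T.V m, (T.V m).erase j = (T.V n).erase i := by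
  have hc : (T.V m \ (T.V n).erase i).card = 1 := by
    rw [Finset.card_sdiff_of_subset h, Finset.card_erase_of_mem i.2, T.card_V, T.card_V]
    omega
  obtain ⟨j, hj⟩ := Finset.card_eq_one.1 hc
  have hj' : j ∈ T.V m \ (T.V n).erase i := by rw [hj]; simp
  refine ⟨⟨j, (Finset.mem_sdiff.1 hj').1⟩, ?_⟩
  rw [Finset.erase_eq, ← hj]
  exact Finset.sdiff_sdiff_eq_self h

/-- An interior point of the hull on a facet is on a facet of a second simplex. -/
theorem exists_partner {n : Fin Ns} {i : T.V n} {x : RSpace (d + 1)}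
    (hx : x ∈ T.openFacet n i) (hint : x ∈ interior T.hull) :
    ∃ m, m ≠ n ∧ ∃ j : T.V m, (T.V m).erase j = (T.V n).erase i := by
  suffices h : ∃ m, m ≠ n ∧ x ∈ T.simplex m by
    obtain ⟨m, hm, hxm⟩ := h
    exact ⟨m, hm, T.exists_erase_eq (T.erase_subset_of_mem_openFacet hx hxm)⟩
  by_contra! hcon
  set g := affGrad (T.lam n i)
  -- Leave simplex `n` through the facet by a small step against the gradient. The step stays in the
  -- hull and, the other simplices being closed and missing `x`, it avoids all of them. It must then
  -- lie in simplex `n`, although its coordinate at `i` is negative.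
  have hγ : Tendsto (fun t : ℝ => x - t • g) (𝓝[>] 0) (𝓝 x) := by
    have : Continuous fun t : ℝ => x - t • g := by fun_prop
    have := this.tendsto 0
    simp only [zero_smul, sub_zero] at this
    exact this.mono_left nhdsWithin_le_nhds
  have h1 := hγ.eventually (isOpen_interior.mem_nhds hint)
  have h2 : ∀ᶠ t : ℝ in 𝓝[>] 0, ∀ m, m ≠ n → x - t • g ∉ T.simplex m := by
    rw [eventually_all]
    intro m
    by_cases hm : m = n
    · simp [hm]
    · filter_upwards [hγ.eventually ((T.isClosed_simplex m).isOpen_compl.mem_nhds (hcon m hm))]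
        with t ht _ using ht
  obtain ⟨t, ht1, ht2, ht⟩ := (h1.and (h2.and self_mem_nhdsWithin)).exists
  have ht1 := interior_subset ht1
  rw [T.hull_eq, Set.mem_iUnion] at ht1
  obtain ⟨m, hm⟩ := ht1
  obtain rfl : m = n := by
    by_contra hmn
    exact ht2 m hmn hm
  have h3 := T.mem_simplex.1 hm i
  rw [sub_eq_add_neg, AffineMap.map_add_real, hx.1, ← neg_smul, inner_smul_right,
    real_inner_self_eq_norm_sq] at h3
  have h4 : 0 < ‖g‖ ^ 2 := by
    have := norm_pos_iff.2 (T.affGrad_lam_ne_zero m i)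
    positivity
  have ht : 0 < t := ht
  nlinarith

/-- An affine function vanishing on a facet is a multiple of the opposite barycentric
coordinate. -/
theorem eq_mul_lam (n : Fin Ns) (i : T.V n) (a : RSpace (d + 1) →ᵃ[ℝ] ℝ)
    (ha : ∀ k : T.V n, k ≠ i → a (T.τ k) = 0) (x : RSpace (d + 1)) :
    a x = a (T.τ i) * T.lam n i x := by
  rw [T.sum_lam_mul n a x, Finset.sum_eq_single i]
  · ring
  · intro k _ hk
    rw [ha k hk, mul_zero]
  · simp

theorem affGrad_eq_smul {a b : RSpace (d + 1) →ᵃ[ℝ] ℝ} {r : ℝ} (h : ∀ x, a x = r * b x) :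
    affGrad a = r • affGrad b := by
  refine ext_inner_right ℝ fun v => ?_
  have h1 := a.map_add_real 0 v
  have h2 := b.map_add_real 0 v
  rw [h, h, h2] at h1
  rw [inner_smul_left]
  simp only [conj_trivial]
  linarith

/-! ### Two simplices sharing a facet -/

section Partner

variable {T} {m n : Fin Ns} {i : T.V n} {j : T.V m}

theorem mem_of_erase_eq (he : (T.V m).erase j = (T.V n).erase i) {k : Fin Ng} (hk : k ∈ T.V n)
    (hki : k ≠ i) : k ∈ T.V m ∧ k ≠ j := by
  have : k ∈ (T.V m).erase j := by rw [he]; exact Finset.mem_erase.2 ⟨hki, hk⟩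
  exact ⟨(Finset.mem_erase.1 this).2, (Finset.mem_erase.1 this).1⟩

/-- Both coordinates vanish on the common facet, so they are proportional. The sign of the factor
tells whether the simplices lie on the same side of it. -/
theorem lam_partner (he : (T.V m).erase j = (T.V n).erase i) (x : RSpace (d + 1)) :
    T.lam m j x = T.lam m j (T.τ i) * T.lam n i x := by
  refine T.eq_mul_lam n i (T.lam m j) (fun k hk => ?_) x
  obtain ⟨h1, h2⟩ := mem_of_erase_eq he k.2 fun h => hk (Subtype.ext h)
  exact T.lam_ne m j ⟨k, h1⟩ fun h => h2 (by rw [h])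

theorem lam_partner_ne_zero (he : (T.V m).erase j = (T.V n).erase i) :
    T.lam m j (T.τ i) ≠ 0 := by
  intro h
  have := lam_partner he (T.τ j)
  rw [T.lam_self, h, zero_mul] at this
  exact one_ne_zero this

theorem lam_partner_of_ne (he : (T.V m).erase j = (T.V n).erase i) {x : RSpace (d + 1)}
    (hx : T.lam n i x = 0) {k : Fin Ng} (hkm : k ∈ T.V m) (hkn : k ∈ T.V n) :
    T.lam m ⟨k, hkm⟩ x = T.lam n ⟨k, hkn⟩ x := by
  rw [T.sum_lam_mul n (T.lam m ⟨k, hkm⟩) x, Finset.sum_eq_single (⟨k, hkn⟩ : T.V n)]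
  · rw [T.lam_self m ⟨k, hkm⟩, mul_one]
  · intro k' _ hk'
    by_cases h : k' = i
    · rw [h, hx, zero_mul]
    · obtain ⟨h1, h2⟩ := mem_of_erase_eq he k'.2 fun h' => h (Subtype.ext h')
      rw [T.lam_ne m ⟨k, hkm⟩ ⟨k', h1⟩ (fun h' => hk' (Subtype.ext (Subtype.mk.inj h').symm)),
        mul_zero]
  · simp

theorem openFacet_subset_partner (he : (T.V m).erase j = (T.V n).erase i) :
    T.openFacet n i ⊆ T.openFacet m j := by
  intro x hx
  refine ⟨by rw [lam_partner he, hx.1, mul_zero], fun k hk => ?_⟩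
  obtain ⟨h1, h2⟩ := mem_of_erase_eq he.symm k.2 fun h => hk (Subtype.ext h)
  rw [lam_partner_of_ne he hx.1 k.2 h1]
  exact hx.2 _ fun h => h2 (by rw [← h])

theorem openFacet_partner (he : (T.V m).erase j = (T.V n).erase i) :
    T.openFacet n i = T.openFacet m j :=
  (openFacet_subset_partner he).antisymm (openFacet_subset_partner he.symm)

end Partner

theorem openFacet_nonempty (n : Fin Ns) (i : T.V n) : (T.openFacet n i).Nonempty := by
  classical
  -- The barycentre of the facet, which has `d + 1` vertices.
  let w : T.V n → ℝ := fun k => if k = i then 0 else ((d : ℝ) + 1)⁻¹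
  have hw : ∑ k, w k = 1 := by
    have hd : (d : ℝ) + 1 ≠ 0 := by positivity
    have h1 : ∑ k ∈ Finset.univ.erase i, w k = ∑ k ∈ Finset.univ.erase i, ((d : ℝ) + 1)⁻¹ :=
      Finset.sum_congr rfl fun k hk => if_neg (Finset.ne_of_mem_erase hk)
    rw [← Finset.add_sum_erase _ _ (Finset.mem_univ i), h1, Finset.sum_const,
      Finset.card_erase_of_mem (Finset.mem_univ i), Finset.card_univ, Fintype.card_coe, T.card_V]
    simp [w, hd]
  have hl : ∀ k, T.lam n k (∑ k, w k • T.τ k) = w k := by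
    intro k
    rw [AffineMap.map_sum_real _ _ hw, Finset.sum_eq_single k]
    · rw [T.lam_self, mul_one]
    · intro k' _ hk'
      rw [T.lam_ne n k k' hk'.symm, mul_zero]
    · simp
  refine ⟨∑ k, w k • T.τ k, ?_, fun k hk => ?_⟩
  · rw [hl]; simp [w]
  · rw [hl]; simp only [w, hk, if_false]; positivity

variable {T} in
/-- Two different simplices with a common facet are on opposite sides of it. -/
theorem lam_partner_neg {m n : Fin Ns} {i : T.V n} {j : T.V m}
    (he : (T.V m).erase j = (T.V n).erase i) (hmn : m ≠ n) : T.lam m j (T.τ i) < 0 := by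
  by_contra hcon
  have hr : 0 < T.lam m j (T.τ i) :=
    lt_of_le_of_ne (not_lt.1 hcon) (lam_partner_ne_zero he).symm
  -- If the factor were positive, a small step from a facet point along `g` would enter both open
  -- simplices at once.
  obtain ⟨x, hx⟩ := T.openFacet_nonempty n i
  set g := affGrad (T.lam n i)
  have hg : 0 < ‖g‖ ^ 2 := by
    have := norm_pos_iff.2 (T.affGrad_lam_ne_zero n i)
    positivity
  have hγ : Tendsto (fun t : ℝ => x + t • g) (𝓝[>] 0) (𝓝 x) := by
    have : Continuous fun t : ℝ => x + t • g := by fun_prop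
    have := this.tendsto 0
    simp only [zero_smul, add_zero] at this
    exact this.mono_left nhdsWithin_le_nhds
  have hpos : ∀ (n' : Fin Ns) (i' : T.V n'), x ∈ T.openFacet n' i' →
      (∀ t : ℝ, 0 < t → 0 < T.lam n' i' (x + t • g)) →
      ∀ᶠ t : ℝ in 𝓝[>] 0, x + t • g ∈ T.openSimplex n' := by
    intro n' i' hx' h
    refine (eventually_all (p := fun k (t : ℝ) => 0 < T.lam n' k (x + t • g))).2 fun k => ?_
    by_cases hk : k = i'
    · subst hk
      filter_upwards [self_mem_nhdsWithin] with t ht using h t ht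
    · exact (((T.lam n' k).continuous_real.tendsto x).comp hγ).eventually_const_lt (hx'.2 k hk)
  have hn : ∀ t : ℝ, T.lam n i (x + t • g) = t * ‖g‖ ^ 2 := fun t => by
    rw [AffineMap.map_add_real, hx.1, inner_smul_right, real_inner_self_eq_norm_sq, zero_add]
  have h1 := hpos n i hx fun t ht => by rw [hn]; positivity
  have h2 := hpos m j (openFacet_subset_partner he hx) fun t ht => by
    rw [lam_partner he, hn]; positivity
  obtain ⟨t, ht1, ht2⟩ := (h1.and h2).exists
  exact hmn (T.eq_of_mem_openSimplex (T.openSimplex_subset_simplex m ht2) ht1)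

variable {T} in
/-- A facet belongs to at most two simplices. -/
theorem partner_unique {n m m' : Fin Ns} {i : T.V n} {j : T.V m} {j' : T.V m'}
    (he : (T.V m).erase j = (T.V n).erase i) (he' : (T.V m').erase j' = (T.V n).erase i)
    (hmn : m ≠ n) (hmn' : m' ≠ n) : m = m' := by
  by_contra h
  have h1 := lam_partner_neg he hmn
  have h2 := lam_partner_neg he' hmn'
  have h3 := lam_partner_neg (he'.trans he.symm) (Ne.symm h)
  -- Three simplices cannot lie pairwise on opposite sides: one of the three negative factors is the
  -- product of the other two.
  have h4 := lam_partner (he'.trans he.symm) (T.τ i)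
  rw [h4] at h2
  nlinarith

variable {T} in
/-- The relative interior of a common facet is in the interior of the hull. -/
theorem openFacet_subset_interior {m n : Fin Ns} {i : T.V n} {j : T.V m}
    (he : (T.V m).erase j = (T.V n).erase i) (hmn : m ≠ n) :
    T.openFacet n i ⊆ interior T.hull := by
  intro x hx
  rw [mem_interior_iff_mem_nhds]
  have hpos : ∀ (n' : Fin Ns) (i' : T.V n'), x ∈ T.openFacet n' i' →
      ∀ᶠ y in 𝓝 x, ∀ k, k ≠ i' → 0 < T.lam n' k y := by
    intro n' i' hx'
    rw [eventually_all]
    intro k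
    by_cases hk : k = i'
    · simp [hk]
    · filter_upwards [((T.lam n' k).continuous_real.tendsto x).eventually_const_lt (hx'.2 k hk)]
        with y hy _ using hy
  filter_upwards [hpos n i hx, hpos m j (openFacet_subset_partner he hx)] with y h1 h2
  by_cases hy : 0 ≤ T.lam n i y
  · refine T.simplex_subset_hull n (T.mem_simplex.2 fun k => ?_)
    by_cases hk : k = i
    · rwa [hk]
    · exact (h1 k hk).le
  · refine T.simplex_subset_hull m (T.mem_simplex.2 fun k => ?_)
    by_cases hk : k = j
    · rw [hk, lam_partner he]
      exact mul_nonneg_of_nonpos_of_nonpos (lam_partner_neg he hmn).le (not_le.1 hy).le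
    · exact (h2 k hk).le

/-- The hull is covered by the open simplices, up to a null set. -/
theorem volume_hull_diff : volume (T.hull \ ⋃ n, T.openSimplex n) = 0 := by
  refine measure_mono_null (t := ⋃ n, ⋃ i : T.V n, {x | T.lam n i x = 0}) ?_ ?_
  · rintro x ⟨hx, hx'⟩
    rw [T.hull_eq, Set.mem_iUnion] at hx
    obtain ⟨n, hn⟩ := hx
    rw [Set.mem_iUnion, not_exists] at hx'
    have := hx' n
    simp only [openSimplex, Set.mem_ofPred_eq, not_forall, not_lt] at this
    obtain ⟨i, hi⟩ := this
    simp only [Set.mem_iUnion]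
    exact ⟨n, i, le_antisymm hi (T.mem_simplex.1 hn i)⟩
  · simp only [measure_iUnion_null_iff]
    intro n i
    exact volume_affine_eq_zero (T.lam n i) (p := T.τ i) (by rw [T.lam_self]; exact one_ne_zero)

/-! ### The affine pieces of the model -/

/-- The affine piece of `f_c` on a simplex. -/
noncomputable def piece (c : Fin Ng → ℝ) (n : Fin Ns) : RSpace (d + 1) →ᵃ[ℝ] ℝ :=
  ∑ i : T.V n, c i • T.lam n i

theorem piece_apply (c : Fin Ng → ℝ) (n : Fin Ns) (x : RSpace (d + 1)) :
    T.piece c n x = ∑ i : T.V n, c i * T.lam n i x := by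
  classical
  have h : ∀ s : Finset (T.V n), (∑ i ∈ s, c i • T.lam n i) x = ∑ i ∈ s, c i * T.lam n i x := by
    intro s
    induction s using Finset.induction_on with
    | empty => simp
    | insert a s ha ih => simp [Finset.sum_insert ha, ih]
  exact h _

theorem piece_vertex (c : Fin Ng → ℝ) (n : Fin Ns) (i : T.V n) :
    T.piece c n (T.τ i) = c i := by
  rw [T.piece_apply, Finset.sum_eq_single i]
  · rw [T.lam_self, mul_one]
  · intro k _ hk
    rw [T.lam_ne n k i hk, mul_zero]
  · simp

/-- The simplex chosen in the definition of `hat` is immaterial, because coordinates agree on common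
faces. -/
theorem hat_of_mem {n : Fin Ns} {k : Fin Ng} (hk : k ∈ T.V n) {x : RSpace (d + 1)}
    (hx : x ∈ T.simplex n) : T.hat k x = T.lam n ⟨k, hk⟩ x := by
  have h : ∃ n, k ∈ T.V n ∧ x ∈ T.simplex n := ⟨n, hk, hx⟩
  rw [hat, dif_pos h]
  obtain ⟨w, -, h1, h2⟩ := T.exists_weights h.choose_spec.2 hx
  rw [h2]
  exact h1 ⟨k, h.choose_spec.1⟩

theorem hat_of_notMem {n : Fin Ns} {k : Fin Ng} (hk : k ∉ T.V n) {x : RSpace (d + 1)}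
    (hx : x ∈ T.simplex n) : T.hat k x = 0 := by
  rw [hat]
  split_ifs with h
  · obtain ⟨w, h0, h1, h2⟩ := T.exists_weights h.choose_spec.2 hx
    rw [← h0 k fun h => hk (Finset.mem_inter.1 h).2]
    exact h1 ⟨k, h.choose_spec.1⟩
  · rfl

theorem fHull_eq_piece (c : Fin Ng → ℝ) {n : Fin Ns} {x : RSpace (d + 1)}
    (hx : x ∈ T.simplex n) : T.fHull c x = T.piece c n x := by
  rw [fHull, T.piece_apply, ← Finset.sum_subset (Finset.subset_univ (T.V n)),
    ← Finset.sum_coe_sort (T.V n)]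
  · refine Finset.sum_congr rfl fun i _ => ?_
    rw [T.hat_of_mem i.2 hx]
  · intro k _ hk
    rw [T.hat_of_notMem hk hx, mul_zero]

end GridTriangulation

/-! ### Integration by parts on each simplex -/

theorem affGrad_sub {d : ℕ} (a b : RSpace d →ᵃ[ℝ] ℝ) : affGrad (a - b) = affGrad a - affGrad b := by
  simp [affGrad]

/-- Bounded pieces of a hyperplane have finite area. -/
theorem euclideanHausdorffMeasure_hyperplane_lt_top {d : ℕ} {a : RSpace (d + 1) →ᵃ[ℝ] ℝ}
    (ha : affGrad a ≠ 0) {K : Set (RSpace (d + 1))} (hK : Bornology.IsBounded K)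
    (hKa : K ⊆ {x | a x = 0}) : μHE[d] K < ⊤ := by
  obtain ⟨ψ, hr, -, -⟩ := exists_hyperplane_chart a ha
  have h : μHE[d] (ψ ⁻¹' K) = μHE[d] K := by
    rw [ψ.isometry.euclideanHausdorffMeasure_preimage, hr, Set.inter_eq_left.2 hKa]
  rw [← h, EuclideanSpace.euclideanHausdorffMeasure_eq_volume]
  exact (ψ.isometry.antilipschitz.isBounded_preimage hK).measure_lt_top

namespace GridTriangulation

variable {d Ng Ns : ℕ} (T : GridTriangulation (d + 1) Ng Ns)

theorem isBounded_hull : Bornology.IsBounded T.hull :=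
  (isBounded_convexHull).2 (Set.finite_range T.τ).isBounded

theorem openFacet_measure_lt_top (n : Fin Ns) (i : T.V n) : μHE[d] (T.openFacet n i) < ⊤ :=
  euclideanHausdorffMeasure_hyperplane_lt_top (T.affGrad_lam_ne_zero n i)
    (T.isBounded_hull.subset ((T.openFacet_subset_simplex n i).trans (T.simplex_subset_hull n)))
    fun _ hx => hx.1

theorem integrableOn_openFacet (n : Fin Ns) (i : T.V n) {φ : RSpace (d + 1) → ℝ}
    (hφ : Continuous φ) (hφc : HasCompactSupport φ) : IntegrableOn φ (T.openFacet n i) μHE[d] := by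
  obtain ⟨M, hM⟩ := hφc.exists_bound_of_continuous hφ
  exact Measure.integrableOn_of_bounded (T.openFacet_measure_lt_top n i).ne
    hφ.aestronglyMeasurable (Eventually.of_forall hM)

/-- The inner unit normal of a facet. -/
noncomputable def normal (n : Fin Ns) (i : T.V n) : RSpace (d + 1) :=
  ‖affGrad (T.lam n i)‖⁻¹ • affGrad (T.lam n i)

theorem norm_normal (n : Fin Ns) (i : T.V n) : ‖T.normal n i‖ = 1 := by
  simp [normal, norm_smul, norm_ne_zero_iff.2 (T.affGrad_lam_ne_zero n i)]

/-- The divergence theorem on a simplex. -/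
theorem integral_openSimplex_fderiv (n : Fin Ns) {φ : RSpace (d + 1) → ℝ} (hφ : ContDiff ℝ 1 φ)
    (hφc : HasCompactSupport φ) (v : RSpace (d + 1)) :
    ∫ x in T.openSimplex n, fderiv ℝ φ x v =
      -∑ i, ⟪T.normal n i, v⟫ * ∫ x in T.openFacet n i, φ x ∂μHE[d] := by
  have h := integral_polyhedron_fderiv (T.lam n) (T.affGrad_lam_ne_zero n) (T.facet_inter_null n)
    hφ hφc v
  rw [openSimplex, h]
  congr 1
  refine Finset.sum_congr rfl fun i _ => ?_
  rw [normal, inner_smul_left, conj_trivial, openFacet]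
  ring

/-- The boundary contribution of a facet of a simplex to the duality product of the second
derivative `∂_p ∂_q` of an affine function with a test function. -/
noncomputable def facetTerm (n : Fin Ns) (i : T.V n) (a : RSpace (d + 1) →ᵃ[ℝ] ℝ)
    (F : 𝓢(RSpace (d + 1), ℝ)) (p q : RSpace (d + 1)) : ℝ :=
  ⟪affGrad a, p⟫ * ⟪T.normal n i, q⟫ * ∫ x in T.openFacet n i, F x ∂μHE[d] -
    ⟪T.normal n i, p⟫ * ∫ x in T.openFacet n i, a x * (∂_{q} F : 𝓢(RSpace (d + 1), ℝ)) x ∂μHE[d]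

/-- With `ψ = ∂_q F`, the product rule gives `a ∂_p ψ = ∂_p (a ψ) - ⟪∇a, p⟫ ∂_q F`. Both terms on
the right are derivatives to which the divergence theorem applies, since `∇a` is constant. -/
theorem integral_openSimplex_lineDeriv (n : Fin Ns) (a : RSpace (d + 1) →ᵃ[ℝ] ℝ)
    (F : 𝓢(RSpace (d + 1), ℝ)) (hF : HasCompactSupport F) (p q : RSpace (d + 1)) :
    IntegrableOn (fun x => a x * (∂_{p} (∂_{q} F) : 𝓢(RSpace (d + 1), ℝ)) x) (T.openSimplex n) ∧
    ∫ x in T.openSimplex n, a x * (∂_{p} (∂_{q} F) : 𝓢(RSpace (d + 1), ℝ)) x =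
      ∑ i, T.facetTerm n i a F p q := by
  set ψ : 𝓢(RSpace (d + 1), ℝ) := ∂_{q} F with hψ
  have hψc : HasCompactSupport ψ :=
    hF.mono' ((subset_tsupport _).trans (SchwartzMap.tsupport_lineDerivOp_subset q F))
  have hψ'c : HasCompactSupport (∂_{p} ψ : 𝓢(RSpace (d + 1), ℝ)) :=
    hψc.mono' ((subset_tsupport _).trans (SchwartzMap.tsupport_lineDerivOp_subset p ψ))
  have hi1 : Integrable (fun x => a x * (∂_{p} ψ : 𝓢(RSpace (d + 1), ℝ)) x) :=
    (a.continuous_real.mul (SchwartzMap.continuous _)).integrable_of_hasCompactSupport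
      hψ'c.mul_left
  have hi2 : Integrable ψ := ψ.continuous.integrable_of_hasCompactSupport hψc
  refine ⟨hi1.integrableOn, ?_⟩
  have hd1 : ∀ x, fderiv ℝ (fun x => a x * ψ x) x p =
      a x * (∂_{p} ψ : 𝓢(RSpace (d + 1), ℝ)) x + ⟪affGrad a, p⟫ * fderiv ℝ F x q := by
    intro x
    have : HasFDerivAt (fun x => a x * ψ x) _ x :=
      (a.hasFDerivAt_real x).mul (ψ.differentiableAt (x := x)).hasFDerivAt
    rw [this.fderiv, ← SchwartzMap.lineDerivOp_apply_eq_fderiv q F, ← hψ,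
      SchwartzMap.lineDerivOp_apply_eq_fderiv p ψ]
    simp [mul_comm]
  have hd2 : ∀ x, fderiv ℝ F x q = ψ x := fun x =>
    (SchwartzMap.lineDerivOp_apply_eq_fderiv q F x).symm
  have h1 := T.integral_openSimplex_fderiv n (φ := fun x => a x * ψ x)
    (a.contDiff_real.mul (ψ.smooth 1)) hψc.mul_left p
  have h2 := T.integral_openSimplex_fderiv n (F.smooth 1) hF q
  simp_rw [hd1] at h1
  rw [integral_add hi1.integrableOn, integral_const_mul, h2] at h1
  · rw [eq_sub_of_add_eq h1]
    simp only [facetTerm, Finset.sum_sub_distrib, mul_neg, Finset.mul_sum, mul_assoc, ← hψ]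
    ring
  · simp_rw [hd2]
    exact (hi2.const_mul _).integrableOn

theorem openSimplex_subset_interior (n : Fin Ns) : T.openSimplex n ⊆ interior T.hull :=
  interior_maximal ((T.openSimplex_subset_simplex n).trans (T.simplex_subset_hull n))
    (T.isOpen_openSimplex n)

theorem integral_interior_hull {f : RSpace (d + 1) → ℝ}
    (hf : ∀ n, IntegrableOn f (T.openSimplex n)) :
    ∫ x in interior T.hull, f x = ∑ n, ∫ x in T.openSimplex n, f x := by
  have hae : (interior T.hull : Set (RSpace (d + 1))) =ᵐ[volume] ⋃ n, T.openSimplex n := by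
    refine (ae_eq_set.2 ⟨?_, ?_⟩)
    · exact measure_mono_null (Set.sdiff_subset_sdiff_left interior_subset) T.volume_hull_diff
    · rw [Set.sdiff_eq_empty.2 (Set.iUnion_subset fun n => T.openSimplex_subset_interior n)]
      simp
  rw [setIntegral_congr_set hae, integral_iUnion_fintype
    (fun n => (T.isOpen_openSimplex n).measurableSet) _ hf]
  intro m n hmn
  refine Set.disjoint_left.2 fun x hm hn => hmn ?_
  exact T.eq_of_mem_openSimplex (T.openSimplex_subset_simplex m hm) hn

theorem hasCompactSupport_of_tsupport_subset {F : RSpace (d + 1) → ℝ}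
    (hF : tsupport F ⊆ interior T.hull) : HasCompactSupport F :=
  Metric.isCompact_of_isClosed_isBounded (isClosed_tsupport _)
    (T.isBounded_hull.subset (hF.trans interior_subset))

/-- The duality product of the Hessian of `f_c` and a test function, as a sum over all facets of
all simplices. -/
theorem hessianPairing_eq_sum_facetTerm (c : Fin Ng → ℝ) (F : MatrixSchwartz (d + 1))
    (hF : ∀ p q, tsupport (F p q : RSpace (d + 1) → ℝ) ⊆ interior T.hull) :
    hessianPairing (interior T.hull) (T.fHull c) F =
      ∑ s : Σ n, T.V n, ∑ p, ∑ q,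
        T.facetTerm s.1 s.2 (T.piece c s.1) (F p q) (canonicalVec p) (canonicalVec q) := by
  have h : ∀ p q, ∫ x in interior T.hull, T.fHull c x *
      (∂_{canonicalVec p} (∂_{canonicalVec q} (F p q)) : 𝓢(RSpace (d + 1), ℝ)) x =
      ∑ s : Σ n, T.V n,
        T.facetTerm s.1 s.2 (T.piece c s.1) (F p q) (canonicalVec p) (canonicalVec q) := by
    intro p q
    have h1 := fun n => T.integral_openSimplex_lineDeriv n (T.piece c n) (F p q)
      (T.hasCompactSupport_of_tsupport_subset (hF p q)) (canonicalVec p) (canonicalVec q)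
    have heq : ∀ n, ∀ x ∈ T.openSimplex n, T.piece c n x *
        (∂_{canonicalVec p} (∂_{canonicalVec q} (F p q)) : 𝓢(RSpace (d + 1), ℝ)) x =
        T.fHull c x *
        (∂_{canonicalVec p} (∂_{canonicalVec q} (F p q)) : 𝓢(RSpace (d + 1), ℝ)) x :=
      fun n x hx => by rw [T.fHull_eq_piece c (T.openSimplex_subset_simplex n hx)]
    rw [T.integral_interior_hull fun n => (integrableOn_congr_fun (heq n)
      (T.isOpen_openSimplex n).measurableSet).1 (h1 n).1, Fintype.sum_sigma]
    refine Finset.sum_congr rfl fun n _ => ?_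
    rw [← (h1 n).2]
    exact (setIntegral_congr_fun (T.isOpen_openSimplex n).measurableSet (heq n)).symm
  simp only [hessianPairing, h]
  rw [Finset.sum_congr rfl fun p _ => Finset.sum_comm, Finset.sum_comm]

/-- By `exists_partner`, a facet without a second simplex contains no interior point of the hull, so
the test function and its derivatives vanish on it. -/
theorem facetTerm_eq_zero {n : Fin Ns} {i : T.V n} (a : RSpace (d + 1) →ᵃ[ℝ] ℝ)
    {F : 𝓢(RSpace (d + 1), ℝ)} (hF : tsupport (F : RSpace (d + 1) → ℝ) ⊆ interior T.hull)
    (h : ¬∃ m, m ≠ n ∧ ∃ j : T.V m, (T.V m).erase j = (T.V n).erase i)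
    (p q : RSpace (d + 1)) : T.facetTerm n i a F p q = 0 := by
  have h0 : ∀ x ∈ T.openFacet n i, x ∉ tsupport (F : RSpace (d + 1) → ℝ) :=
    fun x hx hx' => h (T.exists_partner hx (hF hx'))
  have h1 : ∫ x in T.openFacet n i, F x ∂μHE[d] = 0 :=
    setIntegral_eq_zero_of_forall_eq_zero fun x hx => image_eq_zero_of_notMem_tsupport (h0 x hx)
  have h2 : ∫ x in T.openFacet n i, a x * (∂_{q} F : 𝓢(RSpace (d + 1), ℝ)) x ∂μHE[d] = 0 :=
    setIntegral_eq_zero_of_forall_eq_zero fun x hx => by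
      rw [image_eq_zero_of_notMem_tsupport fun hx' => h0 x hx
        (SchwartzMap.tsupport_lineDerivOp_subset q F hx'), mul_zero]
  rw [facetTerm, h1, h2]
  simp

/-! ### Cancellation across a common facet -/

section Partner

variable {T} {m n : Fin Ns} {i : T.V n} {j : T.V m}

theorem normal_partner (he : (T.V m).erase j = (T.V n).erase i) (hmn : m ≠ n) :
    T.normal m j = -T.normal n i := by
  have hr := lam_partner_neg he hmn
  have hg := norm_ne_zero_iff.2 (T.affGrad_lam_ne_zero n i)
  rw [normal, normal, affGrad_eq_smul (lam_partner he), norm_smul, smul_smul,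
    Real.norm_of_nonpos hr.le, ← neg_smul]
  congr 1
  have := hr.ne
  field_simp

theorem piece_eq_on_openFacet (he : (T.V m).erase j = (T.V n).erase i) (c : Fin Ng → ℝ)
    {x : RSpace (d + 1)} (hx : x ∈ T.openFacet n i) : T.piece c m x = T.piece c n x := by
  rw [← T.fHull_eq_piece c (T.openFacet_subset_simplex n i hx), ← T.fHull_eq_piece c
    (T.openFacet_subset_simplex m j (openFacet_subset_partner he hx))]

/-- The gradient jump across a facet is normal to it. -/
theorem affGrad_piece_sub (he : (T.V m).erase j = (T.V n).erase i) (c : Fin Ng → ℝ) :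
    affGrad (T.piece c n) - affGrad (T.piece c m) =
      ⟪T.normal n i, affGrad (T.piece c n) - affGrad (T.piece c m)⟫ • T.normal n i := by
  -- The difference of the two pieces vanishes at the common vertices, hence is a multiple of the
  -- coordinate opposite to the facet.
  have h := affGrad_eq_smul (T.eq_mul_lam n i (T.piece c n - T.piece c m) fun k hk => by
    obtain ⟨h1, h2⟩ := mem_of_erase_eq he k.2 fun h => hk (Subtype.ext h)
    have h3 := T.piece_vertex c m ⟨k, h1⟩
    simp only at h3
    simp [T.piece_vertex c n k, h3])
  rw [affGrad_sub] at h
  have hg := norm_ne_zero_iff.2 (T.affGrad_lam_ne_zero n i)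
  rw [h, normal, inner_smul_left, inner_smul_right, real_inner_self_eq_norm_sq, smul_smul]
  congr 1
  simp only [conj_trivial]
  field_simp

theorem facetTerm_add_partner (he : (T.V m).erase j = (T.V n).erase i) (hmn : m ≠ n)
    (c : Fin Ng → ℝ) (F : 𝓢(RSpace (d + 1), ℝ)) (p q : RSpace (d + 1)) :
    T.facetTerm n i (T.piece c n) F p q + T.facetTerm m j (T.piece c m) F p q =
      ⟪T.normal n i, affGrad (T.piece c n) - affGrad (T.piece c m)⟫ *
        (⟪T.normal n i, p⟫ * ⟪T.normal n i, q⟫ * ∫ x in T.openFacet n i, F x ∂μHE[d]) := by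
  have h1 : ∫ x in T.openFacet n i, T.piece c m x * (∂_{q} F : 𝓢(RSpace (d + 1), ℝ)) x ∂μHE[d] =
      ∫ x in T.openFacet n i, T.piece c n x * (∂_{q} F : 𝓢(RSpace (d + 1), ℝ)) x ∂μHE[d] :=
    setIntegral_congr_fun (T.measurableSet_openFacet n i) fun x hx => by
      simp only [piece_eq_on_openFacet he c hx]
  have h2 : ⟪affGrad (T.piece c n), p⟫ - ⟪affGrad (T.piece c m), p⟫ =
      ⟪T.normal n i, affGrad (T.piece c n) - affGrad (T.piece c m)⟫ * ⟪T.normal n i, p⟫ := by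
    rw [← inner_sub_left]
    nth_rewrite 1 [affGrad_piece_sub he c]
    rw [inner_smul_left]; simp
  rw [facetTerm, facetTerm, ← openFacet_partner he, normal_partner he hmn, inner_neg_left,
    inner_neg_left, h1]
  -- Opposite normals and equal values on the facet cancel the terms with `∂_q F`; the jump of the
  -- gradient is all that remains.
  linear_combination (⟪T.normal n i, q⟫ * ∫ x in T.openFacet n i, F x ∂μHE[d]) * h2

end Partner

/-! ### Neighbor pairs as pairs of facet sides -/

theorem idx_zero_mem (e : T.NeighborPair) : T.idx e 0 ∈ T.V e.1.1 \ T.V e.1.2 := by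
  simp only [idx, Fin.cons_zero]
  exact Finset.orderEmbOfFin_mem _ e.card_sdiff_left 0

theorem idx_last_mem (e : T.NeighborPair) :
    T.idx e (Fin.last (d + 2)) ∈ T.V e.1.2 \ T.V e.1.1 := by
  rw [idx, ← Fin.succ_last, Fin.cons_succ, Fin.snoc_last]
  exact Finset.orderEmbOfFin_mem _ e.card_sdiff_right 0

theorem idx_castSucc_succ (e : T.NeighborPair) (l : Fin (d + 1)) :
    T.idx e l.castSucc.succ = (T.V e.1.1 ∩ T.V e.1.2).orderEmbOfFin e.2.2 l := by
  rw [idx, Fin.cons_succ, Fin.snoc_castSucc]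

theorem idx_inter_mem (e : T.NeighborPair) (l : Fin (d + 1)) :
    T.idx e l.castSucc.succ ∈ T.V e.1.1 ∩ T.V e.1.2 := by
  rw [idx_castSucc_succ]
  exact Finset.orderEmbOfFin_mem _ e.2.2 l

/-- The vertex of the first simplex opposite to the common facet. -/
noncomputable def apexLeft (e : T.NeighborPair) : T.V e.1.1 :=
  ⟨T.idx e 0, (Finset.mem_sdiff.1 (T.idx_zero_mem e)).1⟩

/-- The vertex of the second simplex opposite to the common facet. -/
noncomputable def apexRight (e : T.NeighborPair) : T.V e.1.2 :=
  ⟨T.idx e (Fin.last (d + 2)), (Finset.mem_sdiff.1 (T.idx_last_mem e)).1⟩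

theorem erase_apexLeft (e : T.NeighborPair) :
    (T.V e.1.1).erase (T.apexLeft e) = T.V e.1.1 ∩ T.V e.1.2 := by
  symm
  refine Finset.eq_of_subset_of_card_le (fun k hk => ?_) ?_
  · rw [Finset.mem_inter] at hk
    refine Finset.mem_erase.2 ⟨?_, hk.1⟩
    rintro rfl
    exact (Finset.mem_sdiff.1 (T.idx_zero_mem e)).2 hk.2
  · rw [Finset.card_erase_of_mem (T.apexLeft e).2, T.card_V, e.2.2]; rfl

theorem erase_apexRight (e : T.NeighborPair) :
    (T.V e.1.2).erase (T.apexRight e) = T.V e.1.1 ∩ T.V e.1.2 := by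
  symm
  refine Finset.eq_of_subset_of_card_le (fun k hk => ?_) ?_
  · rw [Finset.mem_inter] at hk
    refine Finset.mem_erase.2 ⟨?_, hk.2⟩
    rintro rfl
    exact (Finset.mem_sdiff.1 (T.idx_last_mem e)).2 hk.1
  · rw [Finset.card_erase_of_mem (T.apexRight e).2, T.card_V, e.2.2]; rfl

theorem erase_apex (e : T.NeighborPair) :
    (T.V e.1.2).erase (T.apexRight e) = (T.V e.1.1).erase (T.apexLeft e) := by
  rw [erase_apexLeft, erase_apexRight]

theorem eq_apexLeft (e : T.NeighborPair) {i : T.V e.1.1} (hi : (i : Fin Ng) ∉ T.V e.1.2) :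
    i = T.apexLeft e := by
  by_contra h
  have : (i : Fin Ng) ∈ (T.V e.1.1).erase (T.apexLeft e) :=
    Finset.mem_erase.2 ⟨fun h' => h (Subtype.ext h'), i.2⟩
  rw [erase_apexLeft] at this
  exact hi (Finset.mem_inter.1 this).2

theorem eq_apexRight (e : T.NeighborPair) {i : T.V e.1.2} (hi : (i : Fin Ng) ∉ T.V e.1.1) :
    i = T.apexRight e := by
  by_contra h
  have : (i : Fin Ng) ∈ (T.V e.1.2).erase (T.apexRight e) :=
    Finset.mem_erase.2 ⟨fun h' => h (Subtype.ext h'), i.2⟩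
  rw [erase_apexRight] at this
  exact hi (Finset.mem_inter.1 this).1

variable {T} in
theorem NeighborPair.ne (e : T.NeighborPair) : e.1.2 ≠ e.1.1 := e.2.1.ne'

/-- The two sides of a common facet. -/
noncomputable def side : T.NeighborPair ⊕ T.NeighborPair → Σ n, T.V n :=
  Sum.elim (fun e => ⟨e.1.1, T.apexLeft e⟩) (fun e => ⟨e.1.2, T.apexRight e⟩)

/-- A facet with one of its simplices determines the other by `partner_unique`, and `e.1 < e.2`
rules out meeting the same pair in both orders. -/
theorem side_injective : Function.Injective T.side := by
  have h1 : ∀ (n n' : Fin Ns) (i : T.V n) (i' : T.V n'),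
      (⟨n, i⟩ : Σ n, T.V n) = ⟨n', i'⟩ → n = n' ∧ (T.V n).erase i = (T.V n').erase i' := by
    rintro n n' i i' h
    cases h
    exact ⟨rfl, rfl⟩
  rintro (e | e) (e' | e') h
  · obtain ⟨h2, h3⟩ := h1 _ _ _ _ h
    have := partner_unique (T.erase_apex e) ((T.erase_apex e').trans h3.symm) e.ne
      (h2 ▸ e'.ne)
    exact congrArg _ (Subtype.ext (Prod.ext h2 this))
  · obtain ⟨h2, h3⟩ := h1 _ _ _ _ h
    have := partner_unique (T.erase_apex e) ((T.erase_apex e').symm.trans h3.symm) e.ne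
      (h2 ▸ e'.ne.symm)
    have h4 := e.2.1
    have h5 := e'.2.1
    rw [h2, this] at h4
    exact absurd h4 h5.asymm
  · obtain ⟨h2, h3⟩ := h1 _ _ _ _ h
    have := partner_unique (T.erase_apex e') ((T.erase_apex e).symm.trans h3) e'.ne
      (h2 ▸ e.ne.symm)
    have h4 := e.2.1
    have h5 := e'.2.1
    rw [h2, ← this] at h4
    exact absurd h4 h5.asymm
  · obtain ⟨h2, h3⟩ := h1 _ _ _ _ h
    have := partner_unique (T.erase_apex e).symm ((T.erase_apex e').symm.trans h3.symm) e.ne.symm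
      (h2 ▸ e'.ne.symm)
    exact congrArg _ (Subtype.ext (Prod.ext this h2))

/-- With injectivity, this makes `side` a bijection onto the facets that have a partner, so the sum
over all facets of all simplices becomes a sum over neighbor pairs. -/
theorem mem_range_side {n : Fin Ns} {i : T.V n}
    (h : ∃ m, m ≠ n ∧ ∃ j : T.V m, (T.V m).erase j = (T.V n).erase i) :
    (⟨n, i⟩ : Σ n, T.V n) ∈ Set.range T.side := by
  obtain ⟨m, hmn, j, he⟩ := h
  have hi : (i : Fin Ng) ∉ T.V m := by
    intro hi
    refine hmn (T.V_injective (Finset.eq_of_subset_of_card_le (fun k hk => ?_) ?_)).symm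
    · by_cases hki : k = i
      · rwa [hki]
      · exact (mem_of_erase_eq he hk hki).1
    · rw [T.card_V, T.card_V]
  have hinter : T.V n ∩ T.V m = (T.V n).erase i := by
    ext k
    rw [Finset.mem_inter, Finset.mem_erase]
    constructor
    · rintro ⟨h1, h2⟩
      exact ⟨fun h => hi (h ▸ h2), h1⟩
    · rintro ⟨h1, h2⟩
      exact ⟨h2, (mem_of_erase_eq he h2 h1).1⟩
  have hcard : (T.V n ∩ T.V m).card = d + 1 := by
    rw [hinter, Finset.card_erase_of_mem i.2, T.card_V]; rfl
  rcases lt_or_gt_of_ne hmn with h | h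
  · let e : T.NeighborPair := ⟨(m, n), h, by rw [Finset.inter_comm]; exact hcard⟩
    refine ⟨Sum.inr e, ?_⟩
    have := T.eq_apexRight e (i := i) hi
    simp only [side, Sum.elim_inr, ← this]
    rfl
  · let e : T.NeighborPair := ⟨(n, m), h, hcard⟩
    refine ⟨Sum.inl e, ?_⟩
    have := T.eq_apexLeft e (i := i) hi
    simp only [side, Sum.elim_inl, ← this]
    rfl

/-! ### The Hessian as a sum over common facets -/

/-- The common facet of two neighboring simplices, without its relative boundary. -/
def commonFacet (e : T.NeighborPair) : Set (RSpace (d + 1)) := T.openFacet e.1.1 (T.apexLeft e)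

/-- The unit normal of the common facet. -/
noncomputable def facetNormal (e : T.NeighborPair) : RSpace (d + 1) :=
  T.normal e.1.1 (T.apexLeft e)

/-- The jump of the normal derivative of `f_c` across the common facet. -/
noncomputable def jump (c : Fin Ng → ℝ) (e : T.NeighborPair) : ℝ :=
  ⟪T.facetNormal e, affGrad (T.piece c e.1.1) - affGrad (T.piece c e.1.2)⟫

/-- The distributional Hessian of `f_c` is concentrated on the common facets. -/
theorem hessianPairing_fHull (c : Fin Ng → ℝ) (F : MatrixSchwartz (d + 1))
    (hF : ∀ p q, tsupport (F p q : RSpace (d + 1) → ℝ) ⊆ interior T.hull) :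
    hessianPairing (interior T.hull) (T.fHull c) F =
      ∑ e : T.NeighborPair, T.jump c e * ∫ x in T.commonFacet e,
        ∑ p, ∑ q, T.facetNormal e p * T.facetNormal e q * F p q x ∂μHE[d] := by
  have hsum := Fintype.sum_of_injective T.side T.side_injective
    (fun e => ∑ p, ∑ q, T.facetTerm (T.side e).1 (T.side e).2 (T.piece c (T.side e).1) (F p q)
      (canonicalVec p) (canonicalVec q))
    (fun s : Σ n, T.V n => ∑ p, ∑ q, T.facetTerm s.1 s.2 (T.piece c s.1) (F p q)
      (canonicalVec p) (canonicalVec q))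
    (fun s hs => Finset.sum_eq_zero fun p _ => Finset.sum_eq_zero fun q _ =>
      T.facetTerm_eq_zero _ (hF p q) (fun h => hs (T.mem_range_side h)) _ _)
    (fun e => rfl)
  rw [T.hessianPairing_eq_sum_facetTerm c F hF, ← hsum, Fintype.sum_sum_type,
    ← Finset.sum_add_distrib]
  refine Finset.sum_congr rfl fun e _ => ?_
  simp only [side, Sum.elim_inl, Sum.elim_inr, ← Finset.sum_add_distrib]
  have hint : ∀ p q, IntegrableOn (F p q) (T.commonFacet e) μHE[d] := fun p q =>
    T.integrableOn_openFacet _ _ (F p q).continuous (T.hasCompactSupport_of_tsupport_subset (hF p q))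
  rw [integral_finsetSum _ fun p _ => integrable_finsetSum _ fun q _ => (hint p q).const_mul _,
    Finset.mul_sum]
  refine Finset.sum_congr rfl fun p _ => ?_
  rw [integral_finsetSum _ fun q _ => (hint p q).const_mul _, Finset.mul_sum]
  refine Finset.sum_congr rfl fun q _ => ?_
  rw [facetTerm_add_partner (T.erase_apex e) e.ne, integral_const_mul]
  have hv : ∀ (v : RSpace (d + 1)) p, ⟪v, canonicalVec p⟫ = v p := fun v p => by
    simp [canonicalVec, EuclideanSpace.inner_single_right]
  rw [hv, hv]
  rfl

/-! ### Identification of the matrices -/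

theorem lam_vertex (n : Fin Ns) (i j : T.V n) : T.lam n i (T.τ j) = if i = j then 1 else 0 := by
  split_ifs with h
  · rw [h, T.lam_self]
  · exact T.lam_ne n i j h

theorem sum_mul_affGrad (a : RSpace (d + 1) →ᵃ[ℝ] ℝ) (v : RSpace (d + 1)) :
    ∑ j, v j * affGrad a j = ⟪affGrad a, v⟫ := by
  simp [PiLp.inner_apply]

theorem affGrad_inner_sub (a : RSpace (d + 1) →ᵃ[ℝ] ℝ) (x y : RSpace (d + 1)) :
    ∑ j, (x j - y j) * affGrad a j = a x - a y := by
  have h := a.map_add_real y (x - y)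
  rw [add_sub_cancel] at h
  rw [h, ← sum_mul_affGrad]
  simp

/-- The gradient of the affine interpolant on a simplex, from the values at the vertices. -/
theorem inv_mulVec_vertex_sub (c : Fin Ng → ℝ) (n : Fin Ns) (a : T.V n) (v : Fin (d + 1) → T.V n)
    (hv : Function.Injective v) (hva : ∀ l, v l ≠ a) :
    ((Matrix.of fun l j : Fin (d + 1) => T.τ a j - T.τ (v l) j)⁻¹ *ᵥ fun l => c a - c (v l)) =
      affGrad (T.piece c n) := by
  set M : Matrix (Fin (d + 1)) (Fin (d + 1)) ℝ :=
    Matrix.of fun l j : Fin (d + 1) => T.τ a j - T.τ (v l) j with hM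
  -- The inverse has the columns `-∇λ_{v l}`: the increment of `λ_{v l}` from `v k` to `a` is
  -- `-δ_{kl}`.
  have hinv : M * (Matrix.of fun j l => -affGrad (T.lam n (v l)) j) = 1 := by
    ext k l
    simp only [Matrix.mul_apply, hM, Matrix.of_apply, mul_neg, Finset.sum_neg_distrib,
      affGrad_inner_sub, lam_vertex, hva, if_false, Matrix.one_apply, hv.eq_iff]
    simp [eq_comm]
  have hM1 : M *ᵥ (affGrad (T.piece c n)) = fun l => c a - c (v l) := by
    ext l
    simp only [Matrix.mulVec, dotProduct, hM, Matrix.of_apply, affGrad_inner_sub, piece_vertex]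
  rw [← hM1, Matrix.mulVec_mulVec, Matrix.nonsing_inv_mul, Matrix.one_mulVec]
  exact Matrix.isUnit_det_of_right_inverse hinv

theorem idx_inter_injective (e : T.NeighborPair) :
    Function.Injective fun l : Fin (d + 1) => T.idx e l.castSucc.succ := by
  intro l l' h
  simp only [idx_castSucc_succ] at h
  exact ((T.V e.1.1 ∩ T.V e.1.2).orderEmbOfFin e.2.2).injective h

theorem GA_mulVec (c : Fin Ng → ℝ) (e : T.NeighborPair) :
    (T.GA e *ᵥ fun l => c (T.idx e 0) - c (T.idx e l.castSucc.succ)) =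
      affGrad (T.piece c e.1.1) := by
  refine T.inv_mulVec_vertex_sub c e.1.1 (T.apexLeft e)
    (fun l => ⟨T.idx e l.castSucc.succ, (Finset.mem_inter.1 (T.idx_inter_mem e l)).1⟩)
    (fun l l' h => T.idx_inter_injective e (Subtype.mk.inj h)) fun l h => ?_
  have h1 := (Finset.mem_sdiff.1 (T.idx_zero_mem e)).2
  rw [← show T.idx e l.castSucc.succ = T.idx e 0 from Subtype.mk.inj h] at h1
  exact h1 (Finset.mem_inter.1 (T.idx_inter_mem e l)).2

theorem GB_mulVec (c : Fin Ng → ℝ) (e : T.NeighborPair) :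
    (T.GB e *ᵥ fun l => c (T.idx e (Fin.last (d + 2))) - c (T.idx e l.castSucc.succ)) =
      affGrad (T.piece c e.1.2) := by
  refine T.inv_mulVec_vertex_sub c e.1.2 (T.apexRight e)
    (fun l => ⟨T.idx e l.castSucc.succ, (Finset.mem_inter.1 (T.idx_inter_mem e l)).2⟩)
    (fun l l' h => T.idx_inter_injective e (Subtype.mk.inj h)) fun l h => ?_
  have h1 := (Finset.mem_sdiff.1 (T.idx_last_mem e)).2
  rw [← show T.idx e l.castSucc.succ = T.idx e (Fin.last (d + 2)) from Subtype.mk.inj h] at h1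
  exact h1 (Finset.mem_inter.1 (T.idx_inter_mem e l)).1

theorem W_mulVec (c : Fin Ng → ℝ) (e : T.NeighborPair) :
    T.W e *ᵥ c = fun p => c (T.idx e p) := by
  ext p
  simp [W, Matrix.mulVec, dotProduct]

/-- The gradient-difference matrix computes the jump of the gradient. -/
theorem G_mulVec (c : Fin Ng → ℝ) (e : T.NeighborPair) :
    T.G e *ᵥ c = ⇑(affGrad (T.piece c e.1.1) - affGrad (T.piece c e.1.2)) := by
  ext i
  rw [G, ← Matrix.mulVec_mulVec, W_mulVec, PiLp.sub_apply, ← GA_mulVec, ← GB_mulVec]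
  have hsum : ∀ f : Fin (d + 1 + 2) → ℝ, ∑ p, f p =
      f 0 + (∑ l : Fin (d + 1), f l.castSucc.succ + f (Fin.last (d + 2))) := fun f => by
    rw [Fin.sum_univ_succ, Fin.sum_univ_castSucc, Fin.succ_last]
  have hlast : ∀ (a b : ℝ) (f : Fin (d + 1) → ℝ), (Fin.cons a (Fin.snoc f b : Fin (d + 2) → ℝ) :
      Fin (d + 3) → ℝ) (Fin.last (d + 2)) = b := fun a b f => by
    rw [← Fin.succ_last, Fin.cons_succ, Fin.snoc_last]
  simp only [Matrix.mulVec, dotProduct, Matrix.of_apply, Pi.one_apply, mul_one]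
  rw [hsum, hlast]
  simp only [Fin.cons_zero, Fin.cons_succ, Fin.snoc_castSucc, Matrix.sub_apply,
    mul_sub, sub_mul, Finset.sum_sub_distrib, Finset.sum_mul, neg_mul]
  ring

/-- The vertices of the first simplex of a pair of neighbors, in the order of the matrix `N`. -/
noncomputable def vertexLeft (e : T.NeighborPair) (p : Fin (d + 2)) : T.V e.1.1 :=
  ⟨T.idx e p.castSucc, by
    refine Fin.cases ?_ (fun l => ?_) p
    · exact (T.apexLeft e).2
    · rw [← Fin.succ_castSucc]
      exact (Finset.mem_inter.1 (T.idx_inter_mem e l)).1⟩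

theorem vertexLeft_injective (e : T.NeighborPair) : Function.Injective (T.vertexLeft e) := by
  have h0 : ∀ l : Fin (d + 1), T.idx e l.castSucc.succ ≠ T.idx e 0 := fun l h =>
    (Finset.mem_sdiff.1 (T.idx_zero_mem e)).2 (h ▸ (Finset.mem_inter.1 (T.idx_inter_mem e l)).2)
  intro p p' h
  have h : T.idx e p.castSucc = T.idx e p'.castSucc := Subtype.mk.inj h
  revert h
  refine Fin.cases ?_ (fun l => ?_) p <;> refine Fin.cases ?_ (fun l' => ?_) p' <;> intro h
  · rfl
  · rw [← Fin.succ_castSucc] at h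
    exact absurd h.symm (h0 l')
  · rw [← Fin.succ_castSucc] at h
    exact absurd h (h0 l)
  · rw [← Fin.succ_castSucc, ← Fin.succ_castSucc] at h
    rw [T.idx_inter_injective e h]

/-- Pairing the row `(τ̃_pᵀ, 1)` with the gradient and the value at 0 of a barycentric coordinate
evaluates that coordinate at `τ̃_p`. So these data are the columns of the inverse, and the first
column belongs to `τ̃_0`. -/
theorem normalVec_eq (e : T.NeighborPair) :
    T.normalVec e = affGrad (T.lam e.1.1 (T.apexLeft e)) := by
  have hN : T.N e = Matrix.of fun i p => (Fin.snoc
      (fun j : Fin (d + 1) => affGrad (T.lam e.1.1 (T.vertexLeft e p)) j)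
      (T.lam e.1.1 (T.vertexLeft e p) 0) : Fin (d + 2) → ℝ) i := by
    rw [N]
    refine Matrix.inv_eq_right_inv ?_
    ext p q
    rw [Matrix.mul_apply, Fin.sum_univ_castSucc]
    simp only [Matrix.of_apply, Fin.snoc_castSucc, Fin.snoc_last, one_mul, sum_mul_affGrad]
    rw [add_comm, ← AffineMap.eq_inner_add]
    have h := T.lam_vertex e.1.1 (T.vertexLeft e q) (T.vertexLeft e p)
    simp only [(T.vertexLeft_injective e).eq_iff] at h
    rw [Matrix.one_apply]
    simp only [eq_comm (a := p)]
    exact h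
  ext i
  rw [normalVec, hN]
  simp only [Matrix.of_apply, Fin.snoc_castSucc]
  rfl

theorem u_eq (e : T.NeighborPair) : T.u e = T.facetNormal e := by
  rw [u, normalVec_eq]; rfl

theorem commonFacet_subset (e : T.NeighborPair) :
    T.commonFacet e ⊆ T.simplex e.1.1 ∩ T.simplex e.1.2 := fun _ hx =>
  ⟨T.openFacet_subset_simplex _ _ hx,
    T.openFacet_subset_simplex _ _ (openFacet_subset_partner (T.erase_apex e) hx)⟩

/-- The closed facet exceeds the relatively open one by points where a second coordinate vanishes,
which form a null set for `μHE[d]`. -/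
theorem Vol_eq (e : T.NeighborPair) : T.Vol e = (μHE[d] (T.commonFacet e)).toReal := by
  have hsub := T.commonFacet_subset e
  have hnull : μHE[d] ((T.simplex e.1.1 ∩ T.simplex e.1.2) \ T.commonFacet e) = 0 := by
    refine measure_mono_null (t := ⋃ j : {j // j ≠ T.apexLeft e},
      {x | T.lam e.1.1 (T.apexLeft e) x = 0 ∧ T.lam e.1.1 j x = 0}) ?_ ?_
    · rintro x ⟨⟨hA, hB⟩, hx⟩
      have h0 : T.lam e.1.1 (T.apexLeft e) x = 0 := by
        obtain ⟨w, hw, h1, -⟩ := T.exists_weights hA hB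
        rw [h1]
        exact hw _ fun h => (Finset.mem_sdiff.1 (T.idx_zero_mem e)).2 (Finset.mem_inter.1 h).2
      simp only [commonFacet, openFacet, Set.mem_ofPred_eq, h0, true_and, not_forall, not_lt] at hx
      obtain ⟨j, hj, hjx⟩ := hx
      exact Set.mem_iUnion.2 ⟨⟨j, hj⟩, h0, le_antisymm hjx (T.mem_simplex.1 hA j)⟩
    · exact measure_iUnion_null fun j => T.facet_inter_null _ _ _ j.2
  have h : μHE[d] (T.simplex e.1.1 ∩ T.simplex e.1.2) = μHE[d] (T.commonFacet e) := by
    refine measure_congr (ae_eq_set.2 ⟨hnull, ?_⟩)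
    rw [Set.sdiff_eq_empty.2 hsub, measure_empty]
  rw [Vol, Nat.add_sub_cancel, h]

theorem R_dotProduct (c : Fin Ng → ℝ) (e : T.NeighborPair) :
    T.R e ⬝ᵥ c = (μHE[d] (T.commonFacet e)).toReal * T.jump c e := by
  rw [R, smul_dotProduct, ← Matrix.dotProduct_mulVec, G_mulVec, Vol_eq, u_eq, smul_eq_mul, jump,
    PiLp.inner_apply]
  simp [dotProduct, mul_comm]

/-- Column `k` of `W e` is zero unless `k` is one of the indices `idx e p`. -/
theorem ncard_L_le (e : T.NeighborPair) : {k : Fin Ng | T.L e k ≠ 0}.ncard ≤ d + 1 + 2 := by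
  have hsub : {k : Fin Ng | T.L e k ≠ 0} ⊆ Set.range (T.idx e) := by
    intro k hk
    by_contra hcon
    refine hk ?_
    have hW : ∀ p, T.W e p k = 0 := fun p => if_neg fun h => hcon ⟨p, h⟩
    simp [L, R, G, Matrix.vecMul, dotProduct, Matrix.mul_apply, hW]
  refine (Set.ncard_le_ncard hsub (Set.finite_range _)).trans ?_
  rw [← Set.image_univ]
  refine (Set.ncard_image_le Set.finite_univ).trans ?_
  simp [Set.ncard_univ]

end GridTriangulation

/-! ### Admissible test functions and smooth bumps -/

theorem inner_toEuclideanCLM {d : ℕ} (A : Matrix (Fin d) (Fin d) ℝ) (v w : RSpace d) :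
    ⟪v, Matrix.toEuclideanCLM (𝕜 := ℝ) (n := Fin d) A w⟫ = ∑ p, ∑ q, v p * w q * A p q := by
  rw [PiLp.inner_apply]
  refine Finset.sum_congr rfl fun p _ => ?_
  rw [Matrix.ofLp_toEuclideanCLM]
  simp only [Matrix.mulVec, dotProduct, RCLike.inner_apply, conj_trivial, Finset.sum_mul]
  exact Finset.sum_congr rfl fun q _ => by ring

theorem abs_sum_mul_le_one {d : ℕ} {Ω : Set (RSpace d)} {F : MatrixSchwartz d}
    (hF : IsAdmissibleTest Ω F) {v : RSpace d} (hv : ‖v‖ = 1) (x : RSpace d) :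
    |∑ p, ∑ q, v p * v q * F p q x| ≤ 1 := by
  have h := inner_toEuclideanCLM (Matrix.of fun p q => F p q x) v v
  simp only [Matrix.of_apply] at h
  rw [← h]
  refine (abs_real_inner_le_norm _ _).trans ?_
  rw [hv, one_mul]
  refine (ContinuousLinearMap.le_opNorm _ _).trans ?_
  rw [hv, mul_one]
  exact hF.2 x

/-- A smooth bump function equal to `1` on a compact set. -/
theorem exists_bump_eq_one {d : ℕ} {K V : Set (RSpace d)} (hK : IsClosed K) (hV : IsOpen V)
    (hKV : K ⊆ V) : ∃ f : RSpace d → ℝ, ContDiff ℝ (⊤ : ℕ∞) f ∧ (∀ x, 0 ≤ f x ∧ f x ≤ 1) ∧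
      tsupport f ⊆ V ∧ ∀ x ∈ K, f x = 1 := by
  -- The bump will be nonzero exactly on `U`, so its closed support is the closure of `U`, inside
  -- `V`.
  obtain ⟨U, hU, hKU, hUV⟩ := normal_exists_closure_subset hK hV hKV
  obtain ⟨f, hf, hr, hs, h1⟩ := exists_contMDiff_support_eq_eq_one_iff (n := (⊤ : ℕ∞))
    (modelWithCornersSelf ℝ (RSpace d)) hU hK hKU
  refine ⟨f, hf.contDiff, fun x => hr ⟨x, rfl⟩, ?_, fun x hx => (h1 x).1 hx⟩
  rw [tsupport, hs]
  exact hUV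

/-- Disjoint families of compact sets inside an open set have subordinate smooth bumps with disjoint
supports. -/
theorem exists_disjoint_bumps {d : ℕ} {ι : Type*} [Finite ι] {K : ι → Set (RSpace d)}
    {Ω : Set (RSpace d)} (hΩ : IsOpen Ω) (hK : ∀ e, IsCompact (K e)) (hKΩ : ∀ e, K e ⊆ Ω)
    (hd : Pairwise fun e e' => Disjoint (K e) (K e')) :
    ∃ f : ι → RSpace d → ℝ, (∀ e, ContDiff ℝ (⊤ : ℕ∞) (f e)) ∧
      (∀ e x, 0 ≤ f e x ∧ f e x ≤ 1) ∧ (∀ e, tsupport (f e) ⊆ Ω) ∧ (∀ e, ∀ x ∈ K e, f e x = 1) ∧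
      ∀ e e' x, e ≠ e' → f e x ≠ 0 → f e' x = 0 := by
  obtain ⟨U, hU, hUd⟩ := Pairwise.exists_mem_filter_of_disjoint (l := fun e => 𝓝ˢ (K e))
    fun e e' h => disjoint_nhdsSet_nhdsSet (hK e).isClosed (hK e').isClosed (hd h)
  choose f h1 h2 h3 h4 using fun e => exists_bump_eq_one (hK e).isClosed
    (isOpen_interior.inter hΩ : IsOpen (interior (U e) ∩ Ω))
    (Set.subset_inter (subset_interior_iff_mem_nhdsSet.2 (hU e)) (hKΩ e))
  refine ⟨f, h1, h2, fun e => (h3 e).trans Set.inter_subset_right, h4, fun e e' x hne hx => ?_⟩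
  by_contra hx'
  exact Set.disjoint_left.1 (hUd hne)
    (interior_subset (h3 e (subset_tsupport _ hx)).1)
    (interior_subset (h3 e' (subset_tsupport _ hx')).1)

/-! ### Computation of the total variation -/

namespace GridTriangulation

variable {d Ng Ns : ℕ} (T : GridTriangulation (d + 1) Ng Ns)

theorem norm_facetNormal (e : T.NeighborPair) : ‖T.facetNormal e‖ = 1 := T.norm_normal _ _

theorem commonFacet_measure_ne_top (e : T.NeighborPair) : μHE[d] (T.commonFacet e) ≠ ⊤ :=
  (T.openFacet_measure_lt_top _ _).ne

theorem hessianPairing_fHull_le (c : Fin Ng → ℝ) {F : MatrixSchwartz (d + 1)}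
    (hF : IsAdmissibleTest (interior T.hull) F) :
    hessianPairing (interior T.hull) (T.fHull c) F ≤
      ∑ e : T.NeighborPair, |T.jump c e| * (μHE[d] (T.commonFacet e)).toReal := by
  rw [T.hessianPairing_fHull c F hF.1]
  refine Finset.sum_le_sum fun e _ => ?_
  refine (le_abs_self _).trans ?_
  rw [abs_mul]
  refine mul_le_mul_of_nonneg_left ?_ (abs_nonneg _)
  have := norm_setIntegral_le_of_norm_le_const (μ := μHE[d]) (s := T.commonFacet e) (C := 1)
    (f := fun x => ∑ p, ∑ q, T.facetNormal e p * T.facetNormal e q * F p q x)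
    (T.commonFacet_measure_ne_top e).lt_top
    fun x _ => abs_sum_mul_le_one hF (T.norm_facetNormal e) x
  rw [one_mul] at this
  exact this

/-- A shared point forces the two facets to have the same vertices, and a facet belongs to only one
pair of simplices. -/
theorem commonFacet_disjoint {e e' : T.NeighborPair} (hne : e ≠ e') :
    Disjoint (T.commonFacet e) (T.commonFacet e') := by
  refine Set.disjoint_left.2 fun x hx hx' => hne ?_
  have hs := T.commonFacet_subset e' hx'
  have h1 := T.erase_subset_of_mem_openFacet hx hs.1
  have h2 := T.erase_subset_of_mem_openFacet hx hs.2
  have h3 : (T.V e'.1.1).erase (T.apexLeft e') = (T.V e.1.1).erase (T.apexLeft e) := by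
    symm
    refine Finset.eq_of_subset_of_card_le ?_ ?_
    · rw [erase_apexLeft T e']
      exact Finset.subset_inter h1 h2
    · rw [Finset.card_erase_of_mem (T.apexLeft e').2, Finset.card_erase_of_mem (T.apexLeft e).2,
        T.card_V, T.card_V]
  have h4 := (T.erase_apex e').trans h3
  by_cases hA : e'.1.1 = e.1.1
  · have := partner_unique (T.erase_apex e) h4 e.ne (hA ▸ e'.ne)
    exact Subtype.ext (Prod.ext hA.symm this)
  · have hB := partner_unique (T.erase_apex e) h3 e.ne hA
    by_cases hA' : e'.1.2 = e.1.1
    · have h5 := e.2.1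
      have h6 := e'.2.1
      rw [← hA', hB] at h5
      exact absurd h5 h6.asymm
    · have := partner_unique h4 h3 hA' hA
      exact absurd this e'.ne

theorem commonFacet_subset_interior (e : T.NeighborPair) :
    T.commonFacet e ⊆ interior T.hull :=
  openFacet_subset_interior (T.erase_apex e) e.ne

/-- Admissible test functions almost attain the total jump. -/
theorem exists_admissible_ge (c : Fin Ng → ℝ) {δ : ℝ} (hδ : 0 < δ) :
    ∃ F : MatrixSchwartz (d + 1), IsAdmissibleTest (interior T.hull) F ∧
      ∑ e : T.NeighborPair, |T.jump c e| * ((μHE[d] (T.commonFacet e)).toReal - 2 * δ) ≤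
        hessianPairing (interior T.hull) (T.fHull c) F := by
  -- Closures of different facets may meet, so bumps with disjoint supports require retreating to
  -- compact subsets.
  have hcomp : ∀ e : T.NeighborPair, ∃ K ⊆ T.commonFacet e, IsCompact K ∧
      (μHE[d] (T.commonFacet e \ K)).toReal ≤ δ := by
    intro e
    have hm : MeasurableSet (T.commonFacet e) := T.measurableSet_openFacet e.1.1 (T.apexLeft e)
    have : IsFiniteMeasure (μHE[d].restrict (T.commonFacet e)) :=
      ⟨by rw [Measure.restrict_apply_univ]; exact (T.commonFacet_measure_ne_top e).lt_top⟩
    obtain ⟨K, hKs, hK, hμ⟩ := MeasurableSet.exists_isCompact_sdiff_lt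
      (μ := μHE[d].restrict (T.commonFacet e)) hm (measure_ne_top _ _)
      (ε := ENNReal.ofReal δ) (by simpa using hδ)
    refine ⟨K, hKs, hK, ?_⟩
    rw [Measure.restrict_apply (hm.diff hK.measurableSet),
      Set.inter_eq_left.2 Set.sdiff_subset] at hμ
    exact ENNReal.toReal_le_of_le_ofReal hδ.le hμ.le
  choose K hKs hK hμ using hcomp
  obtain ⟨f, hf, hf01, hfs, hf1, hfd⟩ := exists_disjoint_bumps isOpen_interior hK
    (fun e => (hKs e).trans (T.commonFacet_subset_interior e))
    fun e e' h => (T.commonFacet_disjoint h).mono (hKs e) (hKs e')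
  have hfc : ∀ e, HasCompactSupport (f e) := fun e => T.hasCompactSupport_of_tsupport_subset (hfs e)
  let s : T.NeighborPair → ℝ := fun e => (SignType.sign (T.jump c e) : ℝ)
  have hs1 : ∀ e, |s e| ≤ 1 := fun e => by
    rcases lt_trichotomy (T.jump c e) 0 with h | h | h <;> simp [s, h]
  let ν := T.facetNormal
  -- At each point at most one bump is nonzero, so `F x` is there a rank-one matrix `± f_e(x) ν ⊗ ν`
  -- or zero.
  let F : MatrixSchwartz (d + 1) := fun p q =>
    ∑ e, (s e * ν e p * ν e q) • (hfc e).toSchwartzMap (hf e)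
  have hFx : ∀ p q x, F p q x = ∑ e, s e * ν e p * ν e q * f e x := by
    intro p q x
    simp [F]
  have hsum1 : ∀ x, ∑ e, f e x ≤ 1 := by
    intro x
    by_cases h : ∃ e, f e x ≠ 0
    · obtain ⟨e, he⟩ := h
      rw [Finset.sum_eq_single e (fun e' _ hne => hfd e e' x hne.symm he) (by simp)]
      exact (hf01 e x).2
    · push Not at h
      simp [h]
  have hquad : ∀ v w x, ∑ p, ∑ q, v p * w q * F p q x =
      ∑ e, s e * f e x * (⟪v, ν e⟫ * ⟪ν e, w⟫) := by
    intro v w x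
    have h1 : ∀ e, ⟪v, ν e⟫ * ⟪ν e, w⟫ = ∑ p, ∑ q, (v p * ν e p) * (ν e q * w q) := fun e => by
      rw [PiLp.inner_apply, PiLp.inner_apply, Finset.sum_mul_sum]
      refine Finset.sum_congr rfl fun p _ => Finset.sum_congr rfl fun q _ => ?_
      simp only [RCLike.inner_apply, conj_trivial]
      ring
    simp_rw [h1, hFx, Finset.mul_sum]
    rw [Finset.sum_congr rfl fun p _ => Finset.sum_comm, Finset.sum_comm]
    refine Finset.sum_congr rfl fun e _ => Finset.sum_congr rfl fun p _ =>
      Finset.sum_congr rfl fun q _ => ?_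
    ring
  have hadm : IsAdmissibleTest (interior T.hull) F := by
    refine ⟨fun p q => ?_, fun x => ?_⟩
    · have hcl : IsClosed (⋃ e, tsupport (f e)) :=
        isClosed_iUnion_of_finite fun e => isClosed_tsupport _
      refine (closure_minimal ?_ hcl).trans (Set.iUnion_subset hfs)
      intro x hx
      by_contra hcon
      simp only [Set.mem_iUnion, not_exists] at hcon
      refine hx ?_
      rw [hFx]
      exact Finset.sum_eq_zero fun e _ => by
        rw [image_eq_zero_of_notMem_tsupport (hcon e), mul_zero]
    · refine ContinuousLinearMap.opNorm_le_bound _ zero_le_one fun w => ?_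
      rw [one_mul]
      set v := Matrix.toEuclideanCLM (𝕜 := ℝ) (n := Fin (d + 1))
        (Matrix.of fun p q => F p q x) w with hv
      -- The operator norm is bounded by pairing the image `v` of `w` with itself.
      have h1 : ‖v‖ * ‖v‖ = ∑ e, s e * f e x * (⟪v, ν e⟫ * ⟪ν e, w⟫) := by
        rw [← real_inner_self_eq_norm_mul_norm]
        nth_rewrite 2 [hv]
        rw [inner_toEuclideanCLM, ← hquad]
        rfl
      have h2 : ‖v‖ * ‖v‖ ≤ ‖v‖ * ‖w‖ := by
        rw [h1]
        calc _ ≤ ∑ e, f e x * (‖v‖ * ‖w‖) := by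
              refine Finset.sum_le_sum fun e _ => (le_abs_self _).trans ?_
              rw [abs_mul, abs_mul, abs_mul, abs_of_nonneg (hf01 e x).1]
              have h3 := abs_real_inner_le_norm v (ν e)
              have h4 := abs_real_inner_le_norm (ν e) w
              rw [T.norm_facetNormal, mul_one] at h3
              rw [T.norm_facetNormal, one_mul] at h4
              refine mul_le_mul ?_ (mul_le_mul h3 h4 (abs_nonneg _) (norm_nonneg _))
                (by positivity) (hf01 e x).1
              exact mul_le_of_le_one_left (hf01 e x).1 (hs1 e)
          _ = (∑ e, f e x) * (‖v‖ * ‖w‖) := by rw [Finset.sum_mul]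
          _ ≤ 1 * (‖v‖ * ‖w‖) := by gcongr; exact hsum1 x
          _ = _ := one_mul _
      rcases (norm_nonneg v).eq_or_lt with h | h
      · rw [← h]; exact norm_nonneg _
      · exact le_of_mul_le_mul_left h2 h
  refine ⟨F, hadm, ?_⟩
  rw [T.hessianPairing_fHull c F hadm.1]
  refine Finset.sum_le_sum fun e _ => ?_
  set g : RSpace (d + 1) → ℝ := fun x => ∑ p, ∑ q, ν e p * ν e q * F p q x with hg
  have hg1 : ∀ x, |g x| ≤ 1 := fun x => abs_sum_mul_le_one hadm (T.norm_facetNormal e) x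
  have hgK : ∀ x ∈ K e, g x = s e := by
    intro x hx
    rw [hg]
    simp only [hquad]
    rw [Finset.sum_eq_single e (fun e' _ hne => by
      rw [hfd e e' x hne.symm (by rw [hf1 e x hx]; exact one_ne_zero)]; ring) (by simp),
      hf1 e x hx, real_inner_self_eq_norm_sq, T.norm_facetNormal]
    ring
  have hgc : Continuous g := by
    refine continuous_finsetSum _ fun p _ => continuous_finsetSum _ fun q _ => ?_
    exact continuous_const.mul (F p q).continuous
  have hgi : IntegrableOn g (T.commonFacet e) μHE[d] :=
    Measure.integrableOn_of_bounded (T.commonFacet_measure_ne_top e)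
      hgc.aestronglyMeasurable (Eventually.of_forall hg1)
  have hKm := (hK e).measurableSet
  have hSm : MeasurableSet (T.commonFacet e) := T.measurableSet_openFacet e.1.1 (T.apexLeft e)
  have hsplit : ∫ x in T.commonFacet e, g x ∂μHE[d] =
      ∫ x in K e, g x ∂μHE[d] + ∫ x in T.commonFacet e \ K e, g x ∂μHE[d] := by
    rw [← setIntegral_union Set.disjoint_sdiff_right (hSm.diff hKm) (hgi.mono_set (hKs e))
      (hgi.mono_set Set.sdiff_subset), Set.union_sdiff_cancel (hKs e)]
  have hKint : ∫ x in K e, g x ∂μHE[d] = (μHE[d] (K e)).toReal * s e := by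
    rw [setIntegral_congr_fun hKm hgK, setIntegral_const]; rfl
  have hKtop : μHE[d] (K e) ≠ ⊤ :=
    ne_top_of_le_ne_top (T.commonFacet_measure_ne_top e) (measure_mono (hKs e))
  have hmeas : (μHE[d] (T.commonFacet e)).toReal =
      (μHE[d] (K e)).toReal + (μHE[d] (T.commonFacet e \ K e)).toReal := by
    rw [← ENNReal.toReal_add hKtop (ne_top_of_le_ne_top (T.commonFacet_measure_ne_top e)
      (measure_mono Set.sdiff_subset)), ← measure_union Set.disjoint_sdiff_right (hSm.diff hKm),
      Set.union_sdiff_cancel (hKs e)]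
  have hrest : |∫ x in T.commonFacet e \ K e, g x ∂μHE[d]| ≤ δ := by
    have := norm_setIntegral_le_of_norm_le_const (μ := μHE[d]) (s := T.commonFacet e \ K e) (C := 1)
      (f := g) (lt_of_le_of_lt (measure_mono Set.sdiff_subset)
        (T.commonFacet_measure_ne_top e).lt_top) fun x _ => hg1 x
    rw [one_mul] at this
    exact this.trans (hμ e)
  have hsj : T.jump c e * s e = |T.jump c e| := by
    rw [mul_comm]; exact sign_mul_self _
  change _ ≤ T.jump c e * ∫ x in T.commonFacet e, g x ∂μHE[d]
  rw [hsplit, hKint, hmeas, mul_add]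
  have h1 : T.jump c e * ((μHE[d] (K e)).toReal * s e) = |T.jump c e| * (μHE[d] (K e)).toReal := by
    rw [← hsj]; ring
  have h2 : -(|T.jump c e| * δ) ≤ T.jump c e * ∫ x in T.commonFacet e \ K e, g x ∂μHE[d] := by
    refine (abs_le.1 ?_).1
    rw [abs_mul]
    exact mul_le_mul_of_nonneg_left hrest (abs_nonneg _)
  rw [h1]
  -- The two `δ` in the bound: one for the area lost in passing to `K e`, one for the uncontrolled
  -- sign of `g` on the rest of the facet.
  have h3 := mul_le_mul_of_nonneg_left (hμ e) (abs_nonneg (T.jump c e))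
  linarith

theorem HTV_fHull (c : Fin Ng → ℝ) :
    HTV (interior T.hull) (T.fHull c) =
      ((∑ e : T.NeighborPair, |T.jump c e| * (μHE[d] (T.commonFacet e)).toReal : ℝ) : EReal) := by
  refine le_antisymm (iSup_le fun F => EReal.coe_le_coe_iff.2 (T.hessianPairing_fHull_le c F.2)) ?_
  have hlim : Tendsto (fun n : ℕ => ((∑ e : T.NeighborPair, |T.jump c e| *
      ((μHE[d] (T.commonFacet e)).toReal - 2 * (1 / ((n : ℝ) + 1))) : ℝ) : EReal)) atTop
      (𝓝 ((∑ e : T.NeighborPair, |T.jump c e| *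
        ((μHE[d] (T.commonFacet e)).toReal - 2 * 0) : ℝ) : EReal)) := by
    refine (continuous_coe_real_ereal.tendsto _).comp ?_
    exact tendsto_finsetSum _ fun e _ => (tendsto_const_nhds.sub
      (tendsto_one_div_add_atTop_nhds_zero_nat.const_mul 2)).const_mul _
  simp only [mul_zero, sub_zero] at hlim
  refine le_of_tendsto' hlim fun n => ?_
  obtain ⟨F, hF, hle⟩ := T.exists_admissible_ge c (δ := 1 / ((n : ℝ) + 1)) (by positivity)
  exact (EReal.coe_le_coe_iff.2 hle).trans
    (le_iSup (fun F : {F : MatrixSchwartz (d + 1) // IsAdmissibleTest (interior T.hull) F} =>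
      ((hessianPairing (interior T.hull) (T.fHull c) F.1 : ℝ) : EReal)) ⟨F, hF⟩)

theorem HTV_fHull_eq_sum_abs (c : Fin Ng → ℝ) :
    HTV (interior T.hull) (T.fHull c) = ((∑ e : T.NeighborPair, |T.R e ⬝ᵥ c| : ℝ) : EReal) := by
  rw [T.HTV_fHull]
  congr 1
  refine Finset.sum_congr rfl fun e _ => ?_
  rw [R_dotProduct, abs_mul, abs_of_nonneg ENNReal.toReal_nonneg, mul_comm]

theorem sum_abs_R_eq_norm (c : Fin Ng → ℝ) :
    ∑ e : T.NeighborPair, |T.R e ⬝ᵥ c| = ‖WithLp.toLp 1 (T.L *ᵥ c)‖ := by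
  rw [PiLp.norm_eq_of_L1]
  rfl

theorem htvObjective_fHull {M : ℕ} (x : Fin M → RSpace (d + 1)) (y : Fin M → ℝ) (lam : ℝ)
    (c : Fin Ng → ℝ) :
    T.htvObjective x y lam (T.fHull c) = ((T.lassoObjective x y lam c : ℝ) : EReal) := by
  rw [htvObjective, lassoObjective, HTV_fHull_eq_sum_abs, sum_abs_R_eq_norm, ← EReal.coe_mul,
    ← EReal.coe_add, EuclideanSpace.norm_sq_eq, ← Finset.mul_sum]
  congr 4
  ext m
  have : (T.H x *ᵥ c) m = T.fHull c (x m) := by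
    simp [H, fHull, Matrix.mulVec, dotProduct, mul_comm]
  simp [this]

end GridTriangulation

/-! ### The main theorem -/

theorem mainTheorem3 {d Ng Ns : ℕ} (hd : 1 ≤ d) (T : GridTriangulation d Ng Ns) :
    -- the HTV of the model is the `ℓ₁`-norm of `L c`
    (∀ c : Fin Ng → ℝ,
      HTV (interior T.hull) (T.fHull c) = ((∑ e : T.NeighborPair, |T.R e ⬝ᵥ c| : ℝ) : EReal) ∧
      ∑ e : T.NeighborPair, |T.R e ⬝ᵥ c| = ‖WithLp.toLp 1 (T.L *ᵥ c)‖) ∧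
    -- each row of `L` has at most `d + 2` nonzero entries
    (∀ e : T.NeighborPair, {k : Fin Ng | T.L e k ≠ 0}.ncard ≤ d + 2) ∧
    -- HTV-regularized learning is a generalized LASSO
    (∀ (M : ℕ) (x : Fin M → RSpace d) (y : Fin M → ℝ) (lam : ℝ),
      (∀ m, x m ∈ T.hull) → 0 ≤ lam →
      (∀ c : Fin Ng → ℝ,
        T.htvObjective x y lam (T.fHull c) = ((T.lassoObjective x y lam c : ℝ) : EReal)) ∧
      ∀ c : Fin Ng → ℝ,
        IsMinOn (T.htvObjective x y lam) (Set.range T.fHull) (T.fHull c) ↔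
          IsMinOn (T.lassoObjective x y lam) Set.univ c) := by
  -- Writing the dimension as `d + 1` turns the truncated `d - 1` in `Vol` into an honest facet
  -- dimension.
  obtain ⟨d, rfl⟩ := Nat.exists_eq_add_of_le' hd
  refine ⟨fun c => ⟨T.HTV_fHull_eq_sum_abs c, T.sum_abs_R_eq_norm c⟩, T.ncard_L_le,
    fun M x y lam _ _ => ⟨T.htvObjective_fHull x y lam, fun c => ?_⟩⟩
  simp only [isMinOn_iff, Set.forall_mem_range, T.htvObjective_fHull, EReal.coe_le_coe_iff,
    Set.mem_univ, forall_const]
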